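/- Let $G$ be a graph. For disjoint nonempty vertex sets $U,W$ let $d(U,W)$ be the number of edges between $U$ and $W$ divided by $|U||W|$. For $\varepsilon,d>0$, the pair $(U,W)$ is \emph{$(\varepsilon,d)$-regular} if $d(U,W)\ge d$ and $|d(U',W')-d(U,W)|\le\varepsilon$ for all nonempty $U'\subseteq U$, $W'\subseteq W$ with $|U'|\ge\varepsilon|U|$ and $|W'|\ge\varepsilon|W|$. It is \emph{$(\varepsilon,d)$-super-regular} if moreover every $u\in U$ has at least $d|W|$ neighbours in $W$ and every $w\in W$ has at least $d|U|$ neighbours in $U$. For every $\gamma>0$ there exists $d>0$ such that for every $\varepsilon>0$ and every $k_0\in\mathbb N$ there exist $K_0\in\mathbb N$ and $\xi>0$ with the following property. For every $n\ge K_0$ and every balanced bipartite graph $G=(A\,\dot\cup\,B,E)$ on $2n$ vertices (that is, with $|A|=|B|=n$) with minimum degree $\delta(G)\ge(\tfrac12+\gamma)n$ there exist $k$ with $k_0\le k\le K_0$ and non-negative integers $n_1,\dots,n_k$ with $n_1+\dots+n_k=n$ and $n_i\ge n/(2k)$ for all $i$, such that for all non-negative integers $a_1,\dots,a_k$ and $b_1,\dots,b_k$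 with $\sum_i a_i=\sum_i b_i=n$ and $a_i\le n_i+\xi n$, $b_i\le n_i+\xi n$ for all $i\in[k]$, there exist partitions $A=A_1\,\dot\cup\cdots\dot\cup\,A_k$ and $B=B_1\,\dot\cup\cdots\dot\cup\,B_k$ such that for every $i\in[k]$ (with $B_{k+1}:=B_1$) 1. $|A_i|=a_i$ and $|B_i|=b_i$; 2. $(A_i,B_i)$ is $(\varepsilon,d)$-super-regular; 3. $(A_i,B_{i+1})$ is $(\varepsilon,d)$-regular. -/

import Mathlib

/-- `A`, `B` are the two colour classes, each of size `n`, of the balanced bipartite graph `G`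
on `2 * n` vertices. -/
structure IsBalancedBipartition {V : Type*} (G : SimpleGraph V) (A B : Finset V) (n : ℕ) :
    Prop where
  bipartite : G.IsBipartiteWith (A : Set V) (B : Set V)
  cover : ∀ v : V, v ∈ A ∨ v ∈ B
  card_left : A.card = n
  card_right : B.card = n

/-- `S` is the disjoint union of the sets `P i`. -/
structure IsPartitionInto {V ι : Type*} (S : Finset V) (P : ι → Finset V) : Prop where
  disjoint : ∀ i j : ι, i ≠ j → Disjoint (P i) (P j)
  union : ∀ v : V, v ∈ S ↔ ∃ i, v ∈ P i

/-- The pair `(U, W)` of disjoint nonempty vertex sets is `(ε, d)`-regular in `G`. -/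
structure IsRegularPair {V : Type*} (G : SimpleGraph V) [DecidableRel G.Adj] (ε d : ℝ)
    (U W : Finset V) : Prop where
  disjoint : Disjoint U W
  nonempty_left : U.Nonempty
  nonempty_right : W.Nonempty
  density : d ≤ (G.edgeDensity U W : ℝ)
  regular : ∀ U' W' : Finset V, U' ⊆ U → W' ⊆ W → U'.Nonempty → W'.Nonempty →
    ε * (U.card : ℝ) ≤ (U'.card : ℝ) → ε * (W.card : ℝ) ≤ (W'.card : ℝ) →
    |(G.edgeDensity U' W' : ℝ) - (G.edgeDensity U W : ℝ)| ≤ ε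

/-- The number of neighbours of `v` in the set `W`. -/
def degInto {V : Type*} (G : SimpleGraph V) [DecidableRel G.Adj] (W : Finset V) (v : V) : ℕ :=
  (W.filter (fun w => G.Adj v w)).card

/-- The pair `(U, W)` is `(ε, d)`-super-regular in `G`. -/
structure IsSuperRegularPair {V : Type*} (G : SimpleGraph V) [DecidableRel G.Adj] (ε d : ℝ)
    (U W : Finset V) : Prop where
  regular : IsRegularPair G ε d U W
  degree_left : ∀ u ∈ U, d * (W.card : ℝ) ≤ (degInto G W u : ℝ)
  degree_right : ∀ w ∈ W, d * (U.card : ℝ) ≤ (degInto G U w : ℝ)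

/-!
The clusters come from Szemerédi's regularity lemma. Mathlib's version partitions the whole vertex
set and ignores the bipartition, so the intersections of its parts with `A` and with `B` are cut
into chunks of one common size `c`, which inherit uniformity as subsets of the parts that are not too
small. Chunks with many bad partners are discarded, and so are a few more to keep equally many
chunks, `k`, on both sides (`exists_reduced_structure`). The reduced graph on the remaining clusters
is balanced bipartite with minimum degree above `k / 2`, hence has a Hamilton cycle
(`exists_hamiltonian_arrangement`); its edges are alternately the pairs `(A_i, B_i)` and
`(A_i, B_{i+1})`.

All `n_i` may be taken equal up to rounding, so the prescribed sizes differ from `c` by a small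
proportion only. In each cluster a core of vertices of typical degree is kept, slightly smaller than
all prescribed sizes, and the few remaining vertices of `A` have to fill the classes up. A remaining
vertex `v` need not have neighbours in the partner of the class `i` that lacks a vertex, but it has
many neighbours in more than half of the clusters `B_j`, and more than half of the clusters `A_j`
are adjacent to `B_i` in the reduced graph and thus consist mostly of vertices that suit class `i`. So
there are many `j` such that `v` can enter class `j` while a vertex of `A_j` leaves for class `i`;
by Hall's theorem these exchanges can be made simultaneously, with few changes to each cluster
(`exists_reassignment`, `exists_side_partition`). The same is done in `B`. The final classes are
close to the clusters, so regularity is preserved (`isRegularPair_of_isUniform`), and every vertex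
has been placed only where its degree is large.
-/

/-! ### Hamilton cycles in balanced bipartite graphs of large minimum degree -/

/-- The symmetric bipartite adjacency relation on `ι ⊕ κ` given by a relation from `ι` to `κ`. -/
def bipAdj {ι κ : Type*} (R : ι → κ → Prop) : ι ⊕ κ → ι ⊕ κ → Prop
  | .inl i, .inr j => R i j
  | .inr j, .inl i => R i j
  | _, _ => False

theorem bipAdj_symm {ι κ : Type*} {R : ι → κ → Prop} {x y : ι ⊕ κ} (h : bipAdj R x y) :
    bipAdj R y x := by
  rcases x with x | x <;> rcases y with y | y <;> exact h

/-- The list `l` runs once through all elements, and cyclically consecutive elements are related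
by `S`: a Hamilton cycle, written as the list of its vertices. The closing condition is phrased
with `getLast?` and `head?`, as in `List.isChain_append`. -/
structure IsHamiltonianList {W : Type*} (S : W → W → Prop) (l : List W) : Prop where
  nodup : l.Nodup
  mem : ∀ v, v ∈ l
  chain : l.IsChain S
  closing : ∀ x ∈ l.getLast?, ∀ y ∈ l.head?, S x y

theorem IsHamiltonianList.rotate {W : Type*} {S : W → W → Prop} {l₁ l₂ : List W}
    (h : IsHamiltonianList S (l₁ ++ l₂)) : IsHamiltonianList S (l₂ ++ l₁) := by
  rcases eq_or_ne l₁ [] with rfl | h₁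
  · simpa using h
  rcases eq_or_ne l₂ [] with rfl | h₂
  · simpa using h
  obtain ⟨hn, hm, hc, hcl⟩ := h
  rw [List.isChain_append] at hc
  refine ⟨List.nodup_append_comm.1 hn, fun v => ?_, ?_, ?_⟩
  · have := hm v
    simp only [List.mem_append] at this ⊢
    tauto
  · rw [List.isChain_append]
    refine ⟨hc.2.1, hc.1, ?_⟩
    rw [List.getLast?_append_of_ne_nil _ h₂, List.head?_append_of_ne_nil _ h₁] at hcl
    exact hcl
  · rw [List.getLast?_append_of_ne_nil _ h₁, List.head?_append_of_ne_nil _ h₂]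
    exact hc.2.2

theorem IsHamiltonianList.reverse {W : Type*} {S : W → W → Prop} {l : List W}
    (h : IsHamiltonianList S l) (hS : ∀ x y, S x y → S y x) : IsHamiltonianList S l.reverse := by
  refine ⟨List.nodup_reverse.2 h.nodup, fun v => List.mem_reverse.2 (h.mem v), ?_, ?_⟩
  · rw [List.isChain_reverse]
    exact h.chain.imp fun a b => hS a b
  · intro x hx y hy
    rw [List.getLast?_reverse] at hx
    rw [List.head?_reverse] at hy
    exact hS _ _ (h.closing y hy x hx)

/-- The crossing step: a Hamilton path from `a` to `b` whose ends have together more than `|ι|`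
neighbours can be closed to a Hamilton cycle by reversing an initial segment. -/
theorem IsHamiltonianList.of_path {ι κ : Type*} [Fintype ι] [Fintype κ] {R R' : ι → κ → Prop}
    {a : ι} {b : κ} (hR' : ∀ i j, R' i j → R i j ∨ (i = a ∧ j = b))
    (hdeg : Fintype.card ι < {j | R a j}.ncard + {i | R i b}.ncard)
    {l : List (ι ⊕ κ)} (hn : l.Nodup) (hm : ∀ v, v ∈ l) (hc : l.IsChain (bipAdj R'))
    (hhead : l.head? = some (.inl a)) (hlast : l.getLast? = some (.inr b)) :
    ∃ l', IsHamiltonianList (bipAdj R) l' := by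
  classical
  -- Every vertex `inr v` has a predecessor in the path.
  have hpred : ∀ v : κ, ∃ u : ι, ∃ l₁ l₂, l = l₁ ++ Sum.inl u :: Sum.inr v :: l₂ := by
    intro v
    obtain ⟨l₁, l₂, rfl⟩ := List.append_of_mem (hm (.inr v))
    rcases List.eq_nil_or_concat l₁ with rfl | ⟨l₁, x, rfl⟩
    · simp at hhead
    · rw [List.concat_append] at hc
      have h := (List.isChain_append_cons_cons.1 hc).2.1
      rcases x with x | x
      · exact ⟨x, l₁, l₂, by simp⟩
      · exact h.elim
  choose pred hpred using hpred
  have hinj : Function.Injective pred := by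
    intro v w hvw
    obtain ⟨l₁, l₂, h₁⟩ := hpred v
    obtain ⟨l₃, l₄, h₂⟩ := hpred w
    rw [hvw] at h₁
    have hn₁ := hn
    rw [h₁] at hn₁
    rw [h₁] at h₂
    have hnot : ∀ (s : List (ι ⊕ κ)) (t : List (ι ⊕ κ)) (x y : ι ⊕ κ),
        (s ++ x :: y :: t).Nodup → ∀ (s' t' : List (ι ⊕ κ)) (z : ι ⊕ κ),
        s ++ x :: y :: t = s' ++ x :: z :: t' → y = z := by
      intro s t x y hd s' t' z he
      have h1 : (s ++ x :: y :: t)[s.length]? = some x := by simp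
      have h2 : (s ++ x :: y :: t)[s'.length]? = some x := by rw [he]; simp
      have h3 : s.length = s'.length := by
        refine (List.getElem?_inj ?_ hd).1 (h1.trans h2.symm)
        simp
      have := (List.append_inj he h3).2
      simp only [List.cons.injEq, true_and] at this
      exact this.1
    exact Sum.inr_injective (hnot _ _ _ _ hn₁ _ _ _ h₂)
  obtain ⟨v, hav, hub⟩ : ∃ v, R a v ∧ R (pred v) b := by
    by_contra! hcon
    have hdis : Disjoint (pred '' {j | R a j}) {i | R i b} := by
      rw [Set.disjoint_left]
      rintro _ ⟨v, hv, rfl⟩ hu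
      exact hcon v hv hu
    have := Set.ncard_union_eq hdis (Set.toFinite _) (Set.toFinite _)
    rw [Set.ncard_image_of_injective _ hinj] at this
    have h2 := Set.ncard_le_card (pred '' {j | R a j} ∪ {i | R i b})
    rw [Nat.card_eq_fintype_card] at h2
    omega
  obtain ⟨l₁, l₂, rfl⟩ := hpred v
  have hl : l₁ ++ Sum.inl (pred v) :: Sum.inr v :: l₂
      = (l₁ ++ [Sum.inl (pred v)]) ++ (Sum.inr v :: l₂) := by simp
  rw [hl] at hn hc hm hhead hlast
  rw [List.getLast?_append_of_ne_nil _ (by simp)] at hlast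
  rw [List.head?_append_of_ne_nil _ (by simp)] at hhead
  set s := l₁ ++ [Sum.inl (pred v)] with hs
  set t := Sum.inr v :: l₂ with ht
  have hb : Sum.inr b ∈ t := List.mem_of_getLast? hlast
  have ha : Sum.inl a ∈ s := List.mem_of_head? hhead
  have hdis := List.disjoint_of_nodup_append hn
  -- The extra edge `ab` is used in neither segment, since these contain only one end of it.
  have hsc : s.IsChain (bipAdj R) := by
    refine (List.isChain_append.1 hc).1.imp_of_mem_imp fun x y hx hy h => ?_
    rcases x with x | x <;> rcases y with y | y
    · exact h
    · rcases hR' _ _ h with h | ⟨rfl, rfl⟩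
      · exact h
      · exact (hdis hy hb).elim
    · rcases hR' _ _ h with h | ⟨rfl, rfl⟩
      · exact h
      · exact (hdis hx hb).elim
    · exact h
  have htc : t.IsChain (bipAdj R) := by
    refine (List.isChain_append.1 hc).2.1.imp_of_mem_imp fun x y hx hy h => ?_
    rcases x with x | x <;> rcases y with y | y
    · exact h
    · rcases hR' _ _ h with h | ⟨rfl, rfl⟩
      · exact h
      · exact (hdis ha hx).elim
    · rcases hR' _ _ h with h | ⟨rfl, rfl⟩
      · exact h
      · exact (hdis ha hy).elim
    · exact h
  refine ⟨s.reverse ++ t, ?_, ?_, ?_, ?_⟩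
  · rw [List.nodup_append'] at hn ⊢
    refine ⟨List.nodup_reverse.2 hn.1, hn.2.1, fun x hx => hn.2.2 (List.mem_reverse.1 hx)⟩
  · intro x
    have := hm x
    simp only [List.mem_append, List.mem_reverse] at this ⊢
    exact this
  · rw [List.isChain_append]
    refine ⟨?_, htc, ?_⟩
    · rw [List.isChain_reverse]
      exact hsc.imp fun x y h => bipAdj_symm h
    · intro x hx y hy
      rw [List.getLast?_reverse, hhead] at hx
      simp only [ht, List.head?_cons, Option.mem_def, Option.some.injEq] at hx hy
      subst hx hy
      exact hav
  · intro x hx y hy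
    rw [List.getLast?_append_of_ne_nil _ (by simp [ht]), hlast] at hx
    rw [List.head?_append_of_ne_nil _ (by simp [hs]), List.head?_reverse] at hy
    simp only [hs, List.getLast?_append, List.getLast?_singleton, Option.mem_def,
      Option.some.injEq, Option.some_or] at hx hy
    subst hx hy
    exact hub

/-- Deleting one edge `ab` keeps Hamiltonicity if the degrees of `a` and `b` remain large. -/
theorem IsHamiltonianList.delete_edge {ι κ : Type*} [Fintype ι] [Fintype κ] {R R' : ι → κ → Prop}
    {a : ι} {b : κ} (hR' : ∀ i j, R' i j → R i j ∨ (i = a ∧ j = b))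
    (hdeg : Fintype.card ι < {j | R a j}.ncard + {i | R i b}.ncard)
    {l : List (ι ⊕ κ)} (h : IsHamiltonianList (bipAdj R') l) :
    ∃ l', IsHamiltonianList (bipAdj R) l' := by
  have hedge : ∀ x y, bipAdj R' x y → bipAdj R x y ∨ (x = .inl a ∧ y = .inr b) ∨
      (x = .inr b ∧ y = .inl a) := by
    rintro (x | x) (y | y) hxy
    · exact hxy.elim
    · rcases hR' _ _ hxy with h | ⟨rfl, rfl⟩
      · exact Or.inl h
      · exact Or.inr (Or.inl ⟨rfl, rfl⟩)
    · rcases hR' _ _ hxy with h | ⟨rfl, rfl⟩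
      · exact Or.inl h
      · exact Or.inr (Or.inr ⟨rfl, rfl⟩)
    · exact hxy.elim
  -- A cycle using `ab` as its closing edge is a Hamilton path between `a` and `b`.
  have key : ∀ l : List (ι ⊕ κ), IsHamiltonianList (bipAdj R') l →
      ∀ x ∈ l.getLast?, ∀ y ∈ l.head?, ¬ bipAdj R x y →
      ∃ l', IsHamiltonianList (bipAdj R) l' := by
    intro l h x hx y hy hxy
    rcases hedge x y (h.closing x hx y hy) with h' | ⟨rfl, rfl⟩ | ⟨rfl, rfl⟩
    · exact (hxy h').elim
    · have h2 := h.reverse fun _ _ => bipAdj_symm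
      exact of_path hR' hdeg h2.nodup h2.mem h2.chain (by rw [List.head?_reverse]; exact hx)
        (by rw [List.getLast?_reverse]; exact hy)
    · exact of_path hR' hdeg h.nodup h.mem h.chain hy hx
  by_cases hcl : ∀ x ∈ l.getLast?, ∀ y ∈ l.head?, bipAdj R x y
  · by_cases hc : l.IsChain (bipAdj R)
    · exact ⟨l, h.nodup, h.mem, hc, hcl⟩
    · rw [List.isChain_iff_forall_rel_of_append_cons_cons] at hc
      push Not at hc
      obtain ⟨x, y, l₁, l₂, rfl, hxy⟩ := hc
      have h2 : IsHamiltonianList (bipAdj R') ((l₁ ++ [x]) ++ (y :: l₂)) := by simpa using h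
      exact key _ h2.rotate x
        (by rw [List.getLast?_append_of_ne_nil _ (by simp)]; simp) y (by simp) hxy
  · push Not at hcl
    obtain ⟨x, hx, y, hy, hxy⟩ := hcl
    exact key l h x hx y hy hxy

theorem exists_isHamiltonianList {k : ℕ} (R : Fin k → Fin k → Prop)
    (hl : ∀ i, k < 2 * {j | R i j}.ncard) (hr : ∀ j, k < 2 * {i | R i j}.ncard) :
    ∃ l, IsHamiltonianList (bipAdj R) l := by
  classical
  -- Start with a Hamilton cycle of the complete bipartite graph and delete the edges outside `R`.
  have hcomplete : IsHamiltonianList (bipAdj fun _ _ : Fin k => True)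
      ((List.finRange k).flatMap fun i => [Sum.inl i, Sum.inr i]) := by
    have hgen : ∀ L : List (Fin k), (L.flatMap fun i => [Sum.inl i, Sum.inr i]).IsChain
        (bipAdj fun _ _ : Fin k => True) ∧
        (∀ y ∈ (L.flatMap fun i => [(Sum.inl i : Fin k ⊕ Fin k), Sum.inr i]).head?,
          ∃ i, y = .inl i) ∧
        (∀ y ∈ (L.flatMap fun i => [(Sum.inl i : Fin k ⊕ Fin k), Sum.inr i]).getLast?,
          ∃ i, y = .inr i) := by
      intro L
      induction L with
      | nil => simp
      | cons i L ih =>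
        refine ⟨?_, by simp, ?_⟩
        · rw [List.flatMap_cons, List.isChain_append]
          refine ⟨by simp [bipAdj], ih.1, ?_⟩
          intro x hx y hy
          obtain ⟨j, rfl⟩ := ih.2.1 y hy
          simp only [List.getLast?_cons_cons, List.getLast?_singleton, Option.mem_def,
            Option.some.injEq] at hx
          subst hx
          trivial
        · intro y hy
          rw [List.flatMap_cons] at hy
          rcases eq_or_ne (L.flatMap fun i => [(Sum.inl i : Fin k ⊕ Fin k), Sum.inr i]) []
            with h | h
          · rw [h] at hy
            simp only [List.append_nil, List.getLast?_cons_cons, List.getLast?_singleton,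
              Option.mem_def, Option.some.injEq] at hy
            exact ⟨i, hy.symm⟩
          · rw [List.getLast?_append_of_ne_nil _ h] at hy
            exact ih.2.2 y hy
    refine ⟨?_, ?_, (hgen _).1, ?_⟩
    · rw [List.nodup_flatMap]
      refine ⟨by simp, (List.nodup_finRange k).imp ?_⟩
      intro a b hab
      simp [Function.onFun, hab.symm]
    · rintro (i | i) <;> simp
    · intro x hx y hy
      obtain ⟨i, rfl⟩ := (hgen _).2.1 y hy
      obtain ⟨j, rfl⟩ := (hgen _).2.2 x hx
      trivial
  have hdel : ∀ S : Finset (Fin k × Fin k),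
      (∃ l, IsHamiltonianList (bipAdj fun i j => R i j ∨ (i, j) ∈ S) l) →
      ∃ l, IsHamiltonianList (bipAdj R) l := by
    intro S
    induction S using Finset.induction_on with
    | empty => simp
    | insert e S _ ih =>
      rintro ⟨l, h⟩
      refine ih (h.delete_edge (a := e.1) (b := e.2) ?_ ?_)
      · intro i j hij
        simp only [Finset.mem_insert, Prod.ext_iff] at hij
        tauto
      · have h1 := hl e.1
        have h2 := hr e.2
        have h3 : {j | R e.1 j}.ncard ≤ {j | R e.1 j ∨ (e.1, j) ∈ S}.ncard :=
          Set.ncard_le_ncard (fun x hx => Or.inl hx) (Set.toFinite _)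
        have h4 : {i | R i e.2}.ncard ≤ {i | R i e.2 ∨ (i, e.2) ∈ S}.ncard :=
          Set.ncard_le_ncard (fun x hx => Or.inl hx) (Set.toFinite _)
        rw [Fintype.card_fin]
        omega
  exact hdel Finset.univ ⟨_, by simpa using hcomplete⟩

/-- A balanced bipartite graph on `k + k` vertices in which all degrees exceed `k / 2` has a
Hamilton cycle `β 0, α 0, β 1, α 1, …`. -/
theorem exists_hamiltonian_arrangement {k : ℕ} (R : Fin k → Fin k → Prop)
    (hl : ∀ i, k < 2 * {j | R i j}.ncard) (hr : ∀ j, k < 2 * {i | R i j}.ncard) :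
    ∃ α β : Equiv.Perm (Fin k), ∀ i, R (α i) (β i) ∧ R (α i) (β (finRotate k i)) := by
  classical
  rcases k with _ | k
  · exact ⟨1, 1, fun i => i.elim0⟩
  obtain ⟨l, hl, i₀, hi₀⟩ : ∃ l, IsHamiltonianList (bipAdj R) l ∧
      ∃ i₀, l.head? = some (.inl i₀) := by
    obtain ⟨l, h⟩ := exists_isHamiltonianList R hl hr
    rcases l with _ | ⟨x, l⟩
    · exact absurd (h.mem (.inl 0)) (by simp)
    rcases x with x | x
    · exact ⟨_, h, x, rfl⟩
    · refine ⟨_, h.reverse fun _ _ => bipAdj_symm, ?_⟩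
      rw [List.head?_reverse]
      obtain ⟨y, hy⟩ : ∃ y, (Sum.inr x :: l).getLast? = some y :=
        ⟨_, List.getLast?_eq_some_getLast (by simp)⟩
      have := h.closing y hy (.inr x) rfl
      rcases y with y | y
      · exact ⟨y, hy⟩
      · exact this.elim
  have hlen : l.length = 2 * (k + 1) := by
    have h1 : l.toFinset = Finset.univ := by ext x; simp [hl.mem x]
    have h2 := List.toFinset_card_of_nodup hl.nodup
    rw [h1] at h2
    simp at h2
    omega
  have hadj := List.isChain_iff_getElem.1 hl.chain
  have hnext : ∀ t i, t < k + 1 → l[2 * t]? = some (.inl i) →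
      ∃ j, l[2 * t + 1]? = some (.inr j) ∧ R i j := by
    intro t i ht hi
    have h1 := hadj (2 * t) (by omega)
    rw [List.getElem?_eq_getElem (by omega), Option.some.injEq] at hi
    rw [hi] at h1
    rw [List.getElem?_eq_getElem (by omega)]
    rcases h : l[2 * t + 1] with y | y
    · rw [h] at h1; exact h1.elim
    · rw [h] at h1; exact ⟨y, rfl, h1⟩
  have hnext' : ∀ t j, t + 1 < k + 1 → l[2 * t + 1]? = some (.inr j) →
      ∃ i, l[2 * (t + 1)]? = some (.inl i) ∧ R i j := by
    intro t j ht hj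
    have h1 := hadj (2 * t + 1) (by omega)
    rw [List.getElem?_eq_getElem (by omega), Option.some.injEq] at hj
    rw [hj] at h1
    rw [List.getElem?_eq_getElem (by omega)]
    have he : 2 * (t + 1) = 2 * t + 1 + 1 := by ring
    simp only [he]
    rcases h : l[2 * t + 1 + 1] with y | y
    · rw [h] at h1; exact ⟨y, rfl, h1⟩
    · rw [h] at h1; exact h1.elim
  have heven : ∀ t, t < k + 1 → ∃ i, l[2 * t]? = some (.inl i) := by
    intro t
    induction t with
    | zero =>
      rw [List.head?_eq_getElem?] at hi₀
      exact fun _ => ⟨i₀, hi₀⟩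
    | succ t ih =>
      intro ht
      obtain ⟨i, hi⟩ := ih (by omega)
      obtain ⟨j, hj, -⟩ := hnext t i (by omega) hi
      obtain ⟨i', hi', -⟩ := hnext' t j ht hj
      exact ⟨i', hi'⟩
  choose a ha using fun t : Fin (k + 1) => heven t t.2
  choose b hb hab using fun t : Fin (k + 1) => hnext t (a t) t.2 (ha t)
  have hinj : ∀ s t : ℕ, s < 2 * (k + 1) → l[s]? = l[t]? → s = t := fun s t hs h =>
    (List.getElem?_inj (by omega) hl.nodup).1 h
  have hainj : Function.Injective a := by
    intro s t hst
    have := hinj (2 * s) (2 * t) (by omega) (by rw [ha, ha, hst])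
    exact Fin.ext (by omega)
  have hbinj : Function.Injective b := by
    intro s t hst
    have := hinj (2 * s + 1) (2 * t + 1) (by omega) (by rw [hb, hb, hst])
    exact Fin.ext (by omega)
  have hrot : ∀ t, R (a (finRotate (k + 1) t)) (b t) := by
    intro t
    rcases eq_or_ne t (Fin.last k) with rfl | ht
    · rw [finRotate_last]
      refine bipAdj_symm (hl.closing (.inr (b (Fin.last k))) ?_ (.inl (a 0)) ?_)
      · rw [List.getLast?_eq_getElem?, hlen]
        exact hb (Fin.last k)
      · rw [List.head?_eq_getElem?]
        exact ha 0
    · have htk : (t : ℕ) < k := Fin.val_lt_last ht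
      obtain ⟨i, hi, hR⟩ := hnext' t (b t) (by omega) (hb t)
      have h1 := ha (finRotate (k + 1) t)
      rw [coe_finRotate_of_ne_last ht, hi, Option.some.injEq] at h1
      rwa [← Sum.inl_injective h1]
  -- Shift `a` by one, so that `α i` lies between `β i` and `β (i + 1)`.
  refine ⟨(finRotate (k + 1)).trans (Equiv.ofBijective a (Finite.injective_iff_bijective.1 hainj)),
    Equiv.ofBijective b (Finite.injective_iff_bijective.1 hbinj), fun i => ⟨hrot i, hab _⟩⟩

/-! ### Edge counts and regular pairs -/

theorem card_interedges_eq_sum_degInto {V : Type*} (G : SimpleGraph V) [DecidableRel G.Adj]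
    (S T : Finset V) : (G.interedges S T).card = ∑ x ∈ S, degInto G T x := by
  classical
  rw [SimpleGraph.interedges_def, Finset.card_filter, Finset.sum_product]
  simp only [degInto, Finset.card_filter]

theorem edgeDensity_mul_card_mul_card {V : Type*} (G : SimpleGraph V) [DecidableRel G.Adj]
    (S T : Finset V) :
    (G.edgeDensity S T : ℝ) * ((S.card : ℝ) * (T.card : ℝ)) = ∑ x ∈ S, (degInto G T x : ℝ) := by
  have h : ((G.interedges S T).card : ℝ) = ∑ x ∈ S, (degInto G T x : ℝ) := by
    rw [card_interedges_eq_sum_degInto]; push_cast; rfl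
  rw [← h, SimpleGraph.edgeDensity_def]
  push_cast
  rcases Finset.eq_empty_or_nonempty S with rfl | hS
  · simp
  rcases Finset.eq_empty_or_nonempty T with rfl | hT
  · simp [SimpleGraph.interedges_def]
  have h1 : (S.card : ℝ) ≠ 0 := by exact_mod_cast hS.card_pos.ne'
  have h2 : (T.card : ℝ) ≠ 0 := by exact_mod_cast hT.card_pos.ne'
  field_simp

/-- In a uniform pair only few vertices have degree well below the density. -/
theorem card_atypical_le {V : Type*} (G : SimpleGraph V) [DecidableRel G.Adj] {ε δ θ : ℝ}
    {X Y : Finset V} (hU : G.IsUniform ε X Y) (hε : ε ≤ 1) (hδ : δ ≤ (G.edgeDensity X Y : ℝ))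
    (hθ : θ ≤ δ - ε) (hY : Y.Nonempty) :
    ((X.filter fun x => (degInto G Y x : ℝ) < θ * Y.card).card : ℝ) ≤ ε * X.card := by
  by_contra! hcon
  set S := X.filter fun x => (degInto G Y x : ℝ) < θ * Y.card with hS
  have hS0 : (0 : ℝ) < S.card := lt_of_le_of_lt (mul_nonneg hU.pos.le (Nat.cast_nonneg _)) hcon
  have hY0 : (0 : ℝ) < Y.card := by exact_mod_cast hY.card_pos
  have h1 := hU (Finset.filter_subset _ _ : S ⊆ X) (Finset.Subset.refl Y) (by linarith)
    (by nlinarith)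
  have h2 := edgeDensity_mul_card_mul_card G S Y
  have h3 : ∑ x ∈ S, (degInto G Y x : ℝ) ≤ S.card * (θ * Y.card) := by
    rw [← nsmul_eq_mul]
    exact Finset.sum_le_card_nsmul _ _ _ fun x hx => (Finset.mem_filter.1 hx).2.le
  have h4 : (G.edgeDensity S Y : ℝ) ≤ θ := by
    have h5 : (G.edgeDensity S Y : ℝ) * ((S.card : ℝ) * (Y.card : ℝ))
        ≤ θ * ((S.card : ℝ) * (Y.card : ℝ)) := by linarith
    exact le_of_mul_le_mul_right h5 (mul_pos hS0 hY0)
  rw [abs_lt] at h1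
  linarith

/-- Uniformity survives small changes of the two sets: a large part of `P` lies mostly in `X`. -/
theorem isRegularPair_of_isUniform {V : Type*} [DecidableEq V] (G : SimpleGraph V)
    [DecidableRel G.Adj] {ε ε₁ β δ c : ℝ} {X Y P Q : Finset V} (hU : G.IsUniform ε₁ X Y)
    (hε0 : 0 < ε) (hε : ε ≤ 1) (hε₁ : ε₁ ≤ ε / 8) (hβ : β ≤ ε ^ 2 / 16) (hc : 0 < c)
    (hX : (X.card : ℝ) = c) (hY : (Y.card : ℝ) = c) (hδ : δ ≤ (G.edgeDensity X Y : ℝ))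
    (hPQ : Disjoint P Q) (hP : c / 2 ≤ P.card) (hQ : c / 2 ≤ Q.card)
    (hPX : ((P \ X).card : ℝ) ≤ β * c) (hQY : ((Q \ Y).card : ℝ) ≤ β * c) :
    IsRegularPair G ε (δ - ε / 2) P Q := by
  have hpart : ∀ Z P P' : Finset V, c / 2 ≤ (P.card : ℝ) → ((P \ Z).card : ℝ) ≤ β * c →
      P' ⊆ P → ε * P.card ≤ P'.card →
      (1 - ε / 8) * (P'.card : ℝ) ≤ ((P' ∩ Z).card : ℝ) ∧ c * ε₁ ≤ ((P' ∩ Z).card : ℝ) := by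
    intro Z P P' h1 h2 h3 h4
    have h5 : ((P' \ Z).card : ℝ) ≤ (P \ Z).card := by
      exact_mod_cast Finset.card_le_card (Finset.sdiff_subset_sdiff h3 (Finset.Subset.refl _))
    have h6 : ((P' ∩ Z).card : ℝ) + (P' \ Z).card = P'.card := by
      exact_mod_cast Finset.card_inter_add_card_sdiff P' Z
    have h7 : β * c ≤ ε ^ 2 / 16 * c := mul_le_mul_of_nonneg_right hβ hc.le
    have h8 : ε * c / 2 ≤ P'.card := by nlinarith
    have h9 : (1 - ε / 8) * (P'.card : ℝ) ≤ ((P' ∩ Z).card : ℝ) := by nlinarith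
    refine ⟨h9, ?_⟩
    have h10 : c * ε₁ ≤ c * (ε / 8) := mul_le_mul_of_nonneg_left hε₁ hc.le
    nlinarith
  have key : ∀ P' Q' : Finset V, P' ⊆ P → Q' ⊆ Q → ε * P.card ≤ P'.card → ε * Q.card ≤ Q'.card →
      |(G.edgeDensity P' Q' : ℝ) - G.edgeDensity X Y| ≤ ε / 2 := by
    intro P' Q' hP' hQ' hPc hQc
    obtain ⟨p1, p2⟩ := hpart X P P' hP hPX hP' hPc
    obtain ⟨q1, q2⟩ := hpart Y Q Q' hQ hQY hQ' hQc
    have h1 : |(G.edgeDensity (P' ∩ X) (Q' ∩ Y) : ℝ) - G.edgeDensity P' Q'| ≤ 2 * (ε / 8) :=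
      Rel.abs_edgeDensity_sub_edgeDensity_le_two_mul G.Adj Finset.inter_subset_left
        Finset.inter_subset_left (by linarith) p1 q1
    have h2 := hU (Finset.inter_subset_right : P' ∩ X ⊆ X) (Finset.inter_subset_right : Q' ∩ Y ⊆ Y)
      (by rw [hX]; exact p2) (by rw [hY]; exact q2)
    rw [abs_le] at h1 ⊢
    rw [abs_lt] at h2
    constructor <;> linarith [h1.1, h1.2, h2.1, h2.2]
  have hP0 : (0 : ℝ) < P.card := by linarith
  have hQ0 : (0 : ℝ) < Q.card := by linarith
  have hself := key P Q (Finset.Subset.refl _) (Finset.Subset.refl _) (by nlinarith) (by nlinarith)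
  rw [abs_le] at hself
  refine ⟨hPQ, Finset.card_pos.1 (by exact_mod_cast hP0), Finset.card_pos.1 (by exact_mod_cast hQ0),
    by linarith [hself.1], ?_⟩
  intro P' Q' hP' hQ' _ _ hPc hQc
  have h := key P' Q' hP' hQ' hPc hQc
  rw [abs_le] at h ⊢
  constructor <;> linarith [h.1, h.2, hself.1, hself.2]

/-! ### Reassigning vertices to clusters -/

/-- The vertices of `A` outside the disjoint cores `C i` can be distributed so that the `i`-th class
gets exactly `a i` vertices and holds only vertices that are admissible for it, at the cost of
moving some vertices of the sets `D j` to other classes.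

First every vertex `v` outside the cores is given a class `t v` with the right multiplicities,
regardless of admissibility. By Hall's theorem there are distinct vertices `u v`, with `u v` in some
`D j`, such that `v` is admissible for `j` and `u v` is admissible for `t v`. Exchanging each `v`
with `u v` does not change the class sizes. -/
theorem exists_reassignment {V : Type*} [DecidableEq V] {k : ℕ} (A : Finset V)
    (C D : Fin k → Finset V) (a : Fin k → ℕ) (adm : V → Fin k → Prop) (hCA : ∀ i, C i ⊆ A)
    (hC : ∀ i j, i ≠ j → Disjoint (C i) (C j)) (hDC : ∀ i, D i ⊆ C i)
    (hCa : ∀ i, (C i).card ≤ a i) (hsum : ∑ i, a i = A.card)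
    (hadm : ∀ i, ∀ x ∈ C i, adm x i)
    (hmove : ∀ v ∈ A, ∀ t, ∃ S : Finset V, A.card - ∑ i, (C i).card ≤ S.card ∧
      ∀ u ∈ S, ∃ j, u ∈ D j ∧ adm v j ∧ adm u t) :
    ∃ P : Fin k → Finset V, IsPartitionInto A P ∧ (∀ i, (P i).card = a i) ∧
      (∀ i, ∀ x ∈ P i, adm x i) ∧ ∀ i, C i \ P i ⊆ D i := by
  classical
  set U := Finset.univ.biUnion C with hU
  set L := A \ U with hL
  have hUA : U ⊆ A := Finset.biUnion_subset.2 fun i _ => hCA i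
  have hUcard : U.card = ∑ i, (C i).card :=
    Finset.card_biUnion fun i _ j _ hij => hC i j hij
  have hLcard : L.card = A.card - ∑ i, (C i).card := by
    rw [hL, Finset.card_sdiff_of_subset hUA, hUcard]
  have hCL : ∀ i, ∀ x ∈ C i, x ∉ L := fun i x hx hxL =>
    (Finset.mem_sdiff.1 hxL).2 (Finset.mem_biUnion.2 ⟨i, Finset.mem_univ _, hx⟩)
  have hCuniq : ∀ i j x, x ∈ C i → x ∈ C j → i = j := by
    intro i j x hi hj
    by_contra hne
    exact Finset.disjoint_left.1 (hC i j hne) hi hj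
  -- the provisional classes of the vertices outside the cores
  obtain ⟨t, ht⟩ : ∃ t : L → Fin k, ∀ i, (Finset.univ.filter fun v => t v = i).card
      = a i - (C i).card := by
    have hcard : Fintype.card L = Fintype.card (Σ i, Fin (a i - (C i).card)) := by
      rw [Fintype.card_coe, hLcard, Fintype.card_sigma]
      simp only [Fintype.card_fin]
      rw [Finset.sum_tsub_distrib _ fun i _ => hCa i, hsum]
    let e := Fintype.equivOfCardEq hcard
    refine ⟨fun v => (e v).1, fun i => ?_⟩
    have h1 : (Finset.univ.filter fun v => (e v).1 = i).card
        = (Finset.univ.filter fun w : (Σ i, Fin (a i - (C i).card)) => w.1 = i).card := by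
      refine Finset.card_bij (fun v _ => e v) ?_ (fun v _ w _ h => e.injective h) ?_
      · intro v hv
        simpa using hv
      · intro w hw
        exact ⟨e.symm w, by simpa using hw, by simp⟩
    rw [h1, ← Fintype.card_subtype, Fintype.card_congr (Equiv.sigmaSubtype i), Fintype.card_fin]
  -- the exchange partners
  choose S hS hS' using hmove
  obtain ⟨u, hu, huS⟩ : ∃ u : L → V, Function.Injective u ∧
      ∀ v : L, u v ∈ S v (Finset.mem_sdiff.1 v.2).1 (t v) := by
    refine (Finset.all_card_le_biUnion_card_iff_exists_injective _).1 fun T => ?_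
    rcases T.eq_empty_or_nonempty with rfl | ⟨v, hv⟩
    · simp
    calc T.card ≤ Fintype.card L := Finset.card_le_univ T
      _ = A.card - ∑ i, (C i).card := by rw [Fintype.card_coe, hLcard]
      _ ≤ _ := hS v (Finset.mem_sdiff.1 v.2).1 (t v)
      _ ≤ _ := Finset.card_le_card (Finset.subset_biUnion_of_mem
        (fun v : L => S v (Finset.mem_sdiff.1 v.2).1 (t v)) hv)
  choose j hjD hjv hju using fun v : L => hS' v (Finset.mem_sdiff.1 v.2).1 (t v) (u v) (huS v)
  have huC : ∀ v, u v ∈ C (j v) := fun v => hDC _ (hjD v)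
  have huL : ∀ v, u v ∉ L := fun v => hCL _ _ (huC v)
  -- the exchange
  let σ : V → V := fun x =>
    if h : x ∈ L then u ⟨x, h⟩ else if h : ∃ v, u v = x then (h.choose : V) else x
  have hσL : ∀ v : L, σ v = u v := fun v => by simp [σ]
  have hσu : ∀ v : L, σ (u v) = v := by
    intro v
    have h : ∃ w, u w = u v := ⟨v, rfl⟩
    simp only [σ, huL v, dite_false, h, dite_true]
    exact congrArg _ (hu h.choose_spec)
  have hσo : ∀ x, x ∉ L → (∀ v, u v ≠ x) → σ x = x := by
    intro x hx hxu
    have h : ¬ ∃ v, u v = x := by push Not; exact hxu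
    simp only [σ, hx, dite_false, h]
  have hσσ : Function.Involutive σ := by
    intro x
    by_cases hx : x ∈ L
    · rw [show σ x = u ⟨x, hx⟩ from hσL ⟨x, hx⟩, hσu]
    by_cases hxu : ∃ v, u v = x
    · obtain ⟨v, rfl⟩ := hxu
      rw [hσu, hσL]
    · push Not at hxu
      rw [hσo x hx hxu, hσo x hx hxu]
  have hσA : ∀ x ∈ A, σ x ∈ A := by
    intro x hxA
    by_cases hx : x ∈ L
    · rw [show σ x = u ⟨x, hx⟩ from hσL ⟨x, hx⟩]
      exact hCA _ (huC _)
    by_cases hxu : ∃ v, u v = x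
    · obtain ⟨v, rfl⟩ := hxu
      rw [hσu]
      exact (Finset.mem_sdiff.1 v.2).1
    · push Not at hxu
      rwa [hσo x hx hxu]
  let T : Fin k → Finset V := fun i => (Finset.univ.filter fun v => t v = i).image Subtype.val
  have hT : ∀ i x, x ∈ T i ↔ ∃ h : x ∈ L, t ⟨x, h⟩ = i := by
    intro i x
    simp [T]
  let I : Fin k → Finset V := fun i => C i ∪ T i
  have hI : ∀ i x, x ∈ I i ↔ x ∈ C i ∨ ∃ h : x ∈ L, t ⟨x, h⟩ = i := by
    intro i x
    rw [← hT]
    exact Finset.mem_union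
  have hIA : ∀ i, I i ⊆ A := by
    intro i x hx
    rcases (hI i x).1 hx with h | ⟨h, -⟩
    · exact hCA i h
    · exact (Finset.mem_sdiff.1 h).1
  have hIcard : ∀ i, (I i).card = a i := by
    intro i
    have hd : Disjoint (C i) (T i) := by
      rw [Finset.disjoint_left]
      intro x hx hxT
      obtain ⟨h, -⟩ := (hT i x).1 hxT
      exact hCL i x hx h
    rw [Finset.card_union_of_disjoint hd, Finset.card_image_of_injective _ Subtype.val_injective,
      ht]
    have := hCa i
    omega
  have hmem : ∀ i x, x ∈ (I i).image σ ↔ σ x ∈ I i := by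
    intro i x
    rw [Finset.mem_image]
    constructor
    · rintro ⟨y, hy, rfl⟩
      rwa [hσσ]
    · intro h
      exact ⟨σ x, h, hσσ x⟩
  refine ⟨fun i => (I i).image σ, ⟨?_, ?_⟩, ?_, ?_, ?_⟩
  · intro i i' hne
    rw [Finset.disjoint_left]
    intro x hx hx'
    rw [hmem, hI] at hx hx'
    rcases hx with h | ⟨h, rfl⟩ <;> rcases hx' with h' | ⟨h', rfl⟩
    · exact hne (hCuniq _ _ _ h h')
    · exact hCL _ _ h h'
    · exact hCL _ _ h' h
    · exact hne rfl
  · intro x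
    constructor
    · intro hx
      have h1 := hσA x hx
      by_cases h2 : σ x ∈ L
      · exact ⟨t ⟨_, h2⟩, (hmem _ _).2 ((hI _ _).2 (Or.inr ⟨h2, rfl⟩))⟩
      · have h3 : σ x ∈ U := by
          by_contra h
          exact h2 (Finset.mem_sdiff.2 ⟨h1, h⟩)
        obtain ⟨i, -, hi⟩ := Finset.mem_biUnion.1 h3
        exact ⟨i, (hmem _ _).2 ((hI _ _).2 (Or.inl hi))⟩
    · rintro ⟨i, hi⟩
      have := hσA _ (hIA i ((hmem i x).1 hi))
      rwa [hσσ] at this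
  · intro i
    rw [Finset.card_image_of_injective _ hσσ.injective, hIcard]
  · intro i x hx
    rw [hmem, hI] at hx
    by_cases hxL : x ∈ L
    · rw [show σ x = u ⟨x, hxL⟩ from hσL ⟨x, hxL⟩] at hx
      rcases hx with h | ⟨h, -⟩
      · rw [hCuniq _ _ _ h (huC _)]
        exact hjv ⟨x, hxL⟩
      · exact (huL _ h).elim
    by_cases hxu : ∃ v, u v = x
    · obtain ⟨v, rfl⟩ := hxu
      rw [hσu] at hx
      rcases hx with h | ⟨h, rfl⟩
      · exact (hCL _ _ h v.2).elim
      · exact hju v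
    · push Not at hxu
      rw [hσo x hxL hxu] at hx
      rcases hx with h | ⟨h, -⟩
      · exact hadm i x h
      · exact (hxL h).elim
  · intro i x hx
    obtain ⟨hxC, hxP⟩ := Finset.mem_sdiff.1 hx
    rw [hmem, hI] at hxP
    by_cases hxu : ∃ v, u v = x
    · obtain ⟨v, rfl⟩ := hxu
      rw [hCuniq _ _ _ hxC (huC v)]
      exact hjD v
    · push Not at hxu
      rw [hσo x (hCL i x hxC) hxu] at hxP
      exact (hxP (Or.inl hxC)).elim

/-! ### Chunks of a regular partition -/

/-- A set `A` can be covered, up to `s` vertices for each part of `P`, by disjoint `s`-subsets each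
contained in one part. -/
theorem exists_disjoint_chunks {V : Type*} [Fintype V] [DecidableEq V]
    (P : Finpartition (Finset.univ : Finset V)) (A : Finset V) {s : ℕ} (hs : 0 < s) :
    ∃ F : Finset (Finset V), (∀ X ∈ F, X ⊆ A ∧ X.card = s ∧ ∃ W ∈ P.parts, X ⊆ W) ∧
      (∀ X ∈ F, ∀ Y ∈ F, X ≠ Y → Disjoint X Y) ∧
      (A \ F.biUnion id).card ≤ P.parts.card * s := by
  classical
  let T : Finset (Finset (Finset V)) := Finset.univ.filter fun F =>
    (∀ X ∈ F, X ⊆ A ∧ X.card = s ∧ ∃ W ∈ P.parts, X ⊆ W) ∧ ∀ X ∈ F, ∀ Y ∈ F, X ≠ Y → Disjoint X Y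
  obtain ⟨F, hF, hmax⟩ := Finset.exists_max_image T Finset.card ⟨∅, by simp [T]⟩
  simp only [T, Finset.mem_filter, Finset.mem_univ, true_and] at hF hmax
  refine ⟨F, hF.1, hF.2, ?_⟩
  have hsmall : ∀ W ∈ P.parts, ((A \ F.biUnion id) ∩ W).card ≤ s := by
    intro W hW
    by_contra! hcon
    obtain ⟨X, hX, hXs⟩ := Finset.exists_subset_card_eq hcon.le
    have hXF : ∀ Y ∈ F, Disjoint X Y := by
      intro Y hY
      rw [Finset.disjoint_left]
      intro x hx hxY
      have h1 := (Finset.mem_inter.1 (hX hx)).1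
      exact (Finset.mem_sdiff.1 h1).2 (Finset.mem_biUnion.2 ⟨Y, hY, hxY⟩)
    have hXnot : X ∉ F := by
      intro h
      have := hXF X h
      rw [disjoint_self, Finset.bot_eq_empty] at this
      rw [this] at hXs
      simp at hXs
      omega
    have := hmax (insert X F) ⟨?_, ?_⟩
    · rw [Finset.card_insert_of_notMem hXnot] at this
      omega
    · intro Y hY
      rcases Finset.mem_insert.1 hY with rfl | hY
      · exact ⟨fun x hx => (Finset.mem_sdiff.1 (Finset.mem_inter.1 (hX hx)).1).1, hXs, W, hW,
          fun x hx => (Finset.mem_inter.1 (hX hx)).2⟩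
      · exact hF.1 Y hY
    · intro Y hY Z hZ hne
      rcases Finset.mem_insert.1 hY with h | h <;> rcases Finset.mem_insert.1 hZ with h' | h'
      · exact (hne (h.trans h'.symm)).elim
      · exact h ▸ hXF Z h'
      · exact h' ▸ (hXF Y h).symm
      · exact hF.2 Y h Z h' hne
  have hcov : A \ F.biUnion id ⊆ P.parts.biUnion fun W => (A \ F.biUnion id) ∩ W := by
    intro x hx
    obtain ⟨W, hW, hxW⟩ := P.exists_mem (Finset.mem_univ x)
    exact Finset.mem_biUnion.2 ⟨W, hW, Finset.mem_inter.2 ⟨hx, hxW⟩⟩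
  exact (Finset.card_le_card hcov).trans (Finset.card_biUnion_le_card_mul _ _ _ hsmall)

theorem card_biUnion_chunks {V : Type*} [DecidableEq V] {F : Finset (Finset V)} {s : ℕ}
    (hs : ∀ X ∈ F, X.card = s) (hF : ∀ X ∈ F, ∀ Y ∈ F, X ≠ Y → Disjoint X Y) :
    (F.biUnion id).card = F.card * s := by
  exact (Finset.card_biUnion fun X hX Y hY h => hF X hX Y hY h).trans (Finset.sum_const_nat hs)

/-- Large subsets of a uniform pair form a uniform pair. -/
theorem isUniform_of_subset {V : Type*} (G : SimpleGraph V) [DecidableRel G.Adj] {ε₀ ε₁ ρ : ℝ}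
    {W Z X Y : Finset V} (hU : G.IsUniform ε₀ W Z) (hX : X ⊆ W) (hY : Y ⊆ Z)
    (hρX : ρ * W.card ≤ X.card) (hρY : ρ * Z.card ≤ Y.card) (hε₁ : 0 ≤ ε₁) (hε₁' : ε₁ ≤ 1)
    (h1 : ε₀ ≤ ε₁ * ρ) (h2 : 2 * ε₀ ≤ ε₁) : G.IsUniform ε₁ X Y := by
  have hε₀ := hU.pos
  have hlarge : ∀ W X X' : Finset V, ρ * W.card ≤ X.card → (X.card : ℝ) * ε₁ ≤ X'.card →
      (W.card : ℝ) * ε₀ ≤ X'.card := by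
    intro W X X' hW hX
    have hW0 : (0 : ℝ) ≤ W.card := Nat.cast_nonneg _
    nlinarith
  have hself : ∀ X : Finset V, (X.card : ℝ) * ε₁ ≤ X.card := by
    intro X
    have hW0 : (0 : ℝ) ≤ X.card := Nat.cast_nonneg _
    nlinarith
  intro X' hX' Y' hY' hXc hYc
  have h3 := hU (hX'.trans hX) (hY'.trans hY) (hlarge _ _ _ hρX hXc) (hlarge _ _ _ hρY hYc)
  have h4 := hU hX hY (hlarge _ _ _ hρX (hself X)) (hlarge _ _ _ hρY (hself Y))
  rw [abs_lt] at *
  constructor <;> linarith [h3.1, h3.2, h4.1, h4.2]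

/-- The pair `(X, Y)` is contained in a pair of parts of `P` that is uniform in `G`. -/
def InUniformParts {V : Type*} [Fintype V] [DecidableEq V] (G : SimpleGraph V) [DecidableRel G.Adj]
    (P : Finpartition (Finset.univ : Finset V)) (ε₀ : ℝ) (X Y : Finset V) : Prop :=
  ∃ W ∈ P.parts, ∃ Z ∈ P.parts, X ⊆ W ∧ Y ⊆ Z ∧ G.IsUniform ε₀ W Z

theorem InUniformParts.symm {V : Type*} [Fintype V] [DecidableEq V] {G : SimpleGraph V}
    [DecidableRel G.Adj] {P : Finpartition (Finset.univ : Finset V)} {ε₀ : ℝ} {X Y : Finset V}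
    (h : InUniformParts G P ε₀ X Y) : InUniformParts G P ε₀ Y X := by
  obtain ⟨W, hW, Z, hZ, h1, h2, h3⟩ := h
  exact ⟨Z, hZ, W, hW, h2, h1, h3.symm⟩

open Classical in
/-- The chunk pairs outside uniform pairs of parts are few: as disjoint subsets of `V × V` they lie
in the union of the products of the irregular pairs of parts and of the diagonal pairs. -/
theorem card_bad_pairs_le {V : Type*} [Fintype V] (G : SimpleGraph V)
    [DecidableRel G.Adj] (P : Finpartition (Finset.univ : Finset V)) {ε₀ M : ℝ} {s : ℕ}
    {F F' : Finset (Finset V)}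
    (hF : ∀ X ∈ F, X.card = s ∧ ∃ W ∈ P.parts, X ⊆ W)
    (hF' : ∀ X ∈ F', X.card = s ∧ ∃ W ∈ P.parts, X ⊆ W)
    (hd : ∀ X ∈ F, ∀ Y ∈ F, X ≠ Y → Disjoint X Y) (hd' : ∀ X ∈ F', ∀ Y ∈ F', X ≠ Y → Disjoint X Y)
    (hM : ∀ W ∈ P.parts, (W.card : ℝ) ≤ M) (hP : P.IsUniform G ε₀) (hε₀ : 0 ≤ ε₀) :
    (∑ X ∈ F, ((F'.filter fun Y => ¬ InUniformParts G P ε₀ X Y).card : ℝ)) * (s : ℝ) ^ 2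
      ≤ ((P.parts.card : ℝ) ^ 2 * ε₀ + P.parts.card) * M ^ 2 := by
  set E := (F ×ˢ F').filter fun e => ¬ InUniformParts G P ε₀ e.1 e.2 with hE
  have hEcard : (∑ X ∈ F, ((F'.filter fun Y => ¬ InUniformParts G P ε₀ X Y).card : ℝ))
      = E.card := by
    rw [hE, Finset.card_filter, Finset.sum_product]
    push_cast
    refine Finset.sum_congr rfl fun X _ => ?_
    rw [Finset.card_filter]
    push_cast
    rfl
  have h1 : (E.biUnion fun e => e.1 ×ˢ e.2).card = E.card * s ^ 2 := by
    rw [Finset.card_biUnion]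
    · refine Finset.sum_const_nat fun e he => ?_
      obtain ⟨h, -⟩ := Finset.mem_filter.1 he
      obtain ⟨h, h'⟩ := Finset.mem_product.1 h
      rw [Finset.card_product, (hF _ h).1, (hF' _ h').1, sq]
    · intro e he f hf hne
      have he1 := Finset.mem_product.1 (Finset.mem_filter.1 he).1
      have hf1 := Finset.mem_product.1 (Finset.mem_filter.1 hf).1
      rw [Function.onFun, Finset.disjoint_product]
      by_cases h : e.1 = f.1
      · exact Or.inr (hd' _ he1.2 _ hf1.2 fun h' => hne (Prod.ext h h'))
      · exact Or.inl (hd _ he1.1 _ hf1.1 h)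
  set Q := P.nonUniforms G ε₀ ∪ P.parts.diag with hQ
  have h2 : (E.biUnion fun e => e.1 ×ˢ e.2) ⊆ Q.biUnion fun e => e.1 ×ˢ e.2 := by
    intro x hx
    obtain ⟨e, he, hxe⟩ := Finset.mem_biUnion.1 hx
    obtain ⟨h, hbad⟩ := Finset.mem_filter.1 he
    obtain ⟨h, h'⟩ := Finset.mem_product.1 h
    obtain ⟨-, W, hW, hXW⟩ := hF _ h
    obtain ⟨-, Z, hZ, hYZ⟩ := hF' _ h'
    refine Finset.mem_biUnion.2 ⟨(W, Z), ?_, Finset.product_subset_product hXW hYZ hxe⟩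
    rw [hQ, Finset.mem_union, Finpartition.mk_mem_nonUniforms, Finset.mem_diag]
    by_cases hWZ : W = Z
    · exact Or.inr ⟨hW, hWZ⟩
    · exact Or.inl ⟨hW, hZ, hWZ, fun hU => hbad ⟨W, hW, Z, hZ, hXW, hYZ, hU⟩⟩
  have h3 : ((Q.biUnion fun e => e.1 ×ˢ e.2).card : ℝ) ≤ Q.card * M ^ 2 := by
    calc ((Q.biUnion fun e => e.1 ×ˢ e.2).card : ℝ) ≤ ∑ e ∈ Q, ((e.1 ×ˢ e.2).card : ℝ) := by
          exact_mod_cast Finset.card_biUnion_le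
      _ ≤ ∑ e ∈ Q, M ^ 2 := by
          refine Finset.sum_le_sum fun e he => ?_
          have he' : e.1 ∈ P.parts ∧ e.2 ∈ P.parts := by
            rcases e with ⟨W, Z⟩
            rw [hQ, Finset.mem_union, Finpartition.mk_mem_nonUniforms, Finset.mem_diag] at he
            rcases he with h | h
            · exact ⟨h.1, h.2.1⟩
            · exact ⟨h.1, h.2 ▸ h.1⟩
          rw [Finset.card_product, Nat.cast_mul, sq]
          have h0 : (0 : ℝ) ≤ e.1.card := Nat.cast_nonneg _
          exact mul_le_mul (hM _ he'.1) (hM _ he'.2) (Nat.cast_nonneg _) (h0.trans (hM _ he'.1))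
      _ = Q.card * M ^ 2 := by rw [Finset.sum_const, nsmul_eq_mul]
  have h4 : (Q.card : ℝ) ≤ (P.parts.card : ℝ) ^ 2 * ε₀ + P.parts.card := by
    have h5 : (Q.card : ℝ) ≤ (P.nonUniforms G ε₀).card + P.parts.card := by
      have := Finset.card_union_le (P.nonUniforms G ε₀) P.parts.diag
      rw [Finset.diag_card] at this
      exact_mod_cast this
    have h6 : ((P.parts.card * (P.parts.card - 1) : ℕ) : ℝ) ≤ (P.parts.card : ℝ) ^ 2 := by
      rw [sq]
      exact_mod_cast Nat.mul_le_mul_left _ (Nat.sub_le _ _)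
    have h7 := mul_le_mul_of_nonneg_right h6 hε₀
    have h8 : ((P.nonUniforms G ε₀).card : ℝ) ≤ _ := hP
    linarith
  calc _ = ((E.biUnion fun e => e.1 ×ˢ e.2).card : ℝ) := by rw [hEcard, h1]; push_cast; ring
    _ ≤ ((Q.biUnion fun e => e.1 ×ˢ e.2).card : ℝ) := by exact_mod_cast Finset.card_le_card h2
    _ ≤ Q.card * M ^ 2 := h3
    _ ≤ _ := mul_le_mul_of_nonneg_right h4 (sq_nonneg M)

theorem degInto_biUnion_le {V ι : Type*} [DecidableEq V] (G : SimpleGraph V) [DecidableRel G.Adj]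
    (F : Finset ι) (Y : ι → Finset V) (x : V) :
    degInto G (F.biUnion Y) x ≤ ∑ i ∈ F, degInto G (Y i) x := by
  unfold degInto
  rw [Finset.filter_biUnion]
  exact Finset.card_biUnion_le

theorem degInto_union_le {V : Type*} [DecidableEq V] (G : SimpleGraph V) [DecidableRel G.Adj]
    (S T : Finset V) (x : V) : degInto G (S ∪ T) x ≤ degInto G S x + degInto G T x := by
  unfold degInto
  rw [Finset.filter_union]
  exact Finset.card_union_le _ _

theorem degInto_mono {V : Type*} (G : SimpleGraph V) [DecidableRel G.Adj]
    {S T : Finset V} (h : S ⊆ T) (x : V) : degInto G S x ≤ degInto G T x :=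
  Finset.card_le_card (Finset.filter_subset_filter _ h)

theorem degInto_le_card {V : Type*} (G : SimpleGraph V) [DecidableRel G.Adj]
    (S : Finset V) (x : V) : degInto G S x ≤ S.card :=
  Finset.card_filter_le _ _

open Classical in
/-- Counting the edges between a chunk `X` and `B`: minimum degree `D` forces many chunks `Y` in `B`
with `good Y` and with density at least `τ` to `X`. -/
theorem minDegree_le_chunk_count {V : Type*} (G : SimpleGraph V) [DecidableRel G.Adj]
    {B X : Finset V} {F : Finset (Finset V)} {s : ℕ} {D τ : ℝ} (hs : 0 < s) (hX : X.card = s)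
    (hF : ∀ Y ∈ F, Y.card = s) (hD : ∀ x ∈ X, D ≤ (degInto G B x : ℝ)) (hτ : 0 ≤ τ)
    (good : Finset V → Prop) :
    D ≤ (B \ F.biUnion id).card
      + ((F.filter fun Y => good Y ∧ τ ≤ (G.edgeDensity X Y : ℝ)).card : ℝ) * s
      + ((F.filter fun Y => ¬ good Y).card : ℝ) * s + τ * (F.card * s) := by
  have hs0 : (0 : ℝ) < s := by exact_mod_cast hs
  have h1 : ∀ x ∈ X, D ≤ (B \ F.biUnion id).card + ∑ Y ∈ F, (degInto G Y x : ℝ) := by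
    intro x hx
    have h2 : degInto G B x ≤ (B \ F.biUnion id).card + ∑ Y ∈ F, degInto G Y x := by
      calc degInto G B x ≤ degInto G ((B \ F.biUnion id) ∪ F.biUnion id) x :=
            degInto_mono G
              (by rw [Finset.sdiff_union_self_eq_union]; exact Finset.subset_union_left) x
        _ ≤ _ := degInto_union_le G _ _ x
        _ ≤ _ := add_le_add (degInto_le_card G _ x) (degInto_biUnion_le G F id x)
    exact (hD x hx).trans (by exact_mod_cast h2)
  have h3 : ∑ x ∈ X, D ≤ ∑ x ∈ X, (((B \ F.biUnion id).card : ℝ) + ∑ Y ∈ F, (degInto G Y x : ℝ)) :=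
    Finset.sum_le_sum h1
  rw [Finset.sum_const, Finset.sum_add_distrib, Finset.sum_const, nsmul_eq_mul, nsmul_eq_mul,
    Finset.sum_comm, hX] at h3
  have h4 : ∀ Y ∈ F, ∑ x ∈ X, (degInto G Y x : ℝ) ≤
      ((if good Y ∧ τ ≤ (G.edgeDensity X Y : ℝ) then 1 else 0)
      + (if ¬ good Y then 1 else 0) + τ) * (s * s) := by
    intro Y hY
    rw [← edgeDensity_mul_card_mul_card, hX, hF Y hY]
    refine mul_le_mul_of_nonneg_right ?_ (mul_nonneg hs0.le hs0.le)
    have h5 : (G.edgeDensity X Y : ℝ) ≤ 1 := by exact_mod_cast G.edgeDensity_le_one X Y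
    by_cases hg : good Y <;> by_cases ht : τ ≤ (G.edgeDensity X Y : ℝ) <;>
      simp [hg, ht] <;> linarith
  have h6 := Finset.sum_le_sum h4
  rw [← Finset.sum_mul, Finset.sum_add_distrib, Finset.sum_add_distrib, Finset.sum_boole,
    Finset.sum_boole, Finset.sum_const, nsmul_eq_mul] at h6
  refine le_of_mul_le_mul_left ?_ hs0
  linarith

/-! ### The reduced structure -/

/-- Markov's inequality for the number of bad partners of a chunk. -/
theorem card_sub_card_light_le {α : Type*} {F : Finset α} {b : α → ℝ} {s m : ℝ} (hs : 0 ≤ s)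
    (hm : 0 < m) (hb : ∀ x ∈ F, 0 ≤ b x) (hsum : (∑ x ∈ F, b x) * s ^ 2 ≤ m ^ 2)
    [DecidablePred fun x => b x * s ≤ m] :
    (F.card : ℝ) * s - ((F.filter fun x => b x * s ≤ m).card : ℝ) * s ≤ m := by
  classical
  set H := F.filter fun x => ¬ b x * s ≤ m with hH
  have h1 : ((F.filter fun x => b x * s ≤ m).card : ℝ) + H.card = F.card := by
    exact_mod_cast Finset.card_filter_add_card_filter_not _
  have h2 : (H.card : ℝ) * m ≤ (∑ x ∈ F, b x) * s := by
    calc (H.card : ℝ) * m = ∑ x ∈ H, m := by rw [Finset.sum_const, nsmul_eq_mul]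
      _ ≤ ∑ x ∈ H, b x * s := Finset.sum_le_sum fun x hx => (not_le.1 (Finset.mem_filter.1 hx).2).le
      _ ≤ ∑ x ∈ F, b x * s := Finset.sum_le_sum_of_subset_of_nonneg (Finset.filter_subset _ _)
          fun x hx _ => mul_nonneg (hb x hx) hs
      _ = _ := by rw [Finset.sum_mul]
  have h3 : (H.card : ℝ) * s * m ≤ m * m := by nlinarith
  have h4 := le_of_mul_le_mul_right h3 hm
  rw [← h1]
  linarith

open Classical in
/-- A chunk with few bad partners keeps a relative degree above `1 / 2 + g / 4` in the reduced
graph, also after a few chunks have been discarded on the other side. -/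
theorem reduced_degree {V : Type*} [Fintype V] (G : SimpleGraph V) [DecidableRel G.Adj]
    {P : Finpartition (Finset.univ : Finset V)} {B X : Finset V} {F K : Finset (Finset V)}
    {n s : ℕ} {g η ε₀ : ℝ} (hg : 0 ≤ g) (hη : 4 * η ≤ g / 2) (hs : 0 < s) (hX : X.card = s)
    (hF : ∀ Y ∈ F, Y ⊆ B ∧ Y.card = s) (hd : ∀ Y ∈ F, ∀ Z ∈ F, Y ≠ Z → Disjoint Y Z)
    (hB : B.card = n) (hcov : ((B \ F.biUnion id).card : ℝ) ≤ η * n)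
    (hD : ∀ x ∈ X, (1 / 2 + g) * (n : ℝ) ≤ (degInto G B x : ℝ))
    (hlight : ((F.filter fun Y => ¬ InUniformParts G P ε₀ X Y).card : ℝ) * s ≤ η * n) (hK : K ⊆ F)
    (hKc : (F.card : ℝ) * s - (K.card : ℝ) * s ≤ 2 * (η * n)) :
    (1 / 2 + g / 4) * (K.card : ℝ) ≤ ((K.filter fun Y =>
      InUniformParts G P ε₀ X Y ∧ g / 4 ≤ (G.edgeDensity X Y : ℝ)).card : ℝ) := by
  have hs0 : (0 : ℝ) < s := by exact_mod_cast hs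
  have h1 := minDegree_le_chunk_count G hs hX (fun Y hY => (hF Y hY).2) hD
    (by linarith : 0 ≤ g / 4) (InUniformParts G P ε₀ X)
  set p := fun Y => InUniformParts G P ε₀ X Y ∧ g / 4 ≤ (G.edgeDensity X Y : ℝ) with hp
  have hFn : (F.card : ℝ) * s ≤ n := by
    have h2 := card_biUnion_chunks (fun Y hY => (hF Y hY).2) hd
    have h3 := Finset.card_le_card (Finset.biUnion_subset.2 fun Y hY => (hF Y hY).1 :
      F.biUnion id ⊆ B)
    rw [h2, hB] at h3
    exact_mod_cast h3
  have hsplit : ((F.filter p).card : ℝ) ≤ (K.filter p).card + ((F.card : ℝ) - K.card) := by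
    have h2 : F.filter p ⊆ K.filter p ∪ (F \ K) := by
      intro Y hY
      obtain ⟨h, h'⟩ := Finset.mem_filter.1 hY
      by_cases hYK : Y ∈ K
      · exact Finset.mem_union_left _ (Finset.mem_filter.2 ⟨hYK, h'⟩)
      · exact Finset.mem_union_right _ (Finset.mem_sdiff.2 ⟨h, hYK⟩)
    have h3 := (Finset.card_le_card h2).trans (Finset.card_union_le _ _)
    have h4 := Finset.card_sdiff_add_card_eq_card hK
    have h5 : ((F.filter p).card : ℝ) ≤ (K.filter p).card + (F \ K).card := by exact_mod_cast h3
    have h6 : ((F \ K).card : ℝ) + K.card = F.card := by exact_mod_cast h4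
    linarith
  have hKn : (K.card : ℝ) * s ≤ n := by
    refine le_trans (mul_le_mul_of_nonneg_right ?_ hs0.le) hFn
    exact_mod_cast Finset.card_le_card hK
  have h2 := mul_le_mul_of_nonneg_right hsplit hs0.le
  have h3 : g / 4 * ((F.card : ℝ) * s) ≤ g / 4 * n :=
    mul_le_mul_of_nonneg_left hFn (by linarith)
  have h4 : (1 / 2 + g / 4) * ((K.card : ℝ) * s) ≤ (1 / 2 + g / 4) * n :=
    mul_le_mul_of_nonneg_left hKn (by linarith)
  have h5 : 4 * η * n ≤ g / 2 * n := mul_le_mul_of_nonneg_right hη (Nat.cast_nonneg n)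
  refine le_of_mul_le_mul_right ?_ hs0
  linarith

theorem ncard_setOf_equiv_symm {α : Type*} {k : ℕ} {K : Finset α} (e : K ≃ Fin k) (p : α → Prop)
    [DecidablePred p] : {j | p (e.symm j)}.ncard = (K.filter p).card := by
  have hinj : Function.Injective fun j => (e.symm j : α) :=
    Subtype.val_injective.comp e.symm.injective
  rw [← Set.ncard_image_of_injective _ hinj, ← Set.ncard_coe_finset]
  congr 1
  ext x
  simp only [Set.mem_image, Set.mem_ofPred_eq, Finset.coe_filter]
  constructor
  · rintro ⟨j, hj, rfl⟩
    exact ⟨(e.symm j).2, hj⟩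
  · rintro ⟨hx, hpx⟩
    exact ⟨e ⟨x, hx⟩, by simpa using hpx, by simp⟩

theorem IsBalancedBipartition.swap {V : Type*} {G : SimpleGraph V} {A B : Finset V} {n : ℕ}
    (h : IsBalancedBipartition G A B n) : IsBalancedBipartition G B A n :=
  ⟨h.bipartite.symm, fun v => (h.cover v).symm, h.card_right, h.card_left⟩

theorem IsBalancedBipartition.minDegree_le_degInto {V : Type*} [Fintype V] {G : SimpleGraph V}
    [DecidableRel G.Adj] {A B : Finset V} {n : ℕ} (h : IsBalancedBipartition G A B n) {x : V}
    (hx : x ∈ A) : G.minDegree ≤ degInto G B x := by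
  refine (G.minDegree_le_degree x).trans (Finset.card_le_card fun y hy => ?_)
  rw [SimpleGraph.mem_neighborFinset] at hy
  rw [Finset.mem_filter]
  rcases h.bipartite.mem_of_adj hy with h1 | h1
  · exact ⟨by exact_mod_cast h1.2, hy⟩
  · exact (Set.disjoint_left.1 h.bipartite.disjoint (by exact_mod_cast hx) h1.1).elim

set_option maxHeartbeats 1000000 in
/-- The regularity lemma for balanced bipartite graphs of minimum degree at least `(1 / 2 + g) n`:
apart from a few vertices, both sides are partitioned into the same number `k` of clusters of
the same size `c`, and the reduced graph `R`, in which edges are uniform pairs of density at least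
`g / 4`, has minimum degree at least `(1 / 2 + g / 4) k`. -/
theorem exists_reduced_structure {g ε₁ : ℝ} (hg : 0 < g) (hg' : g ≤ 1 / 2) (hε₁ : 0 < ε₁)
    (hε₁g : ε₁ ≤ g) (k₀ : ℕ) :
    ∃ K₀ : ℕ, ∀ n : ℕ, K₀ ≤ n → ∀ (V : Type*) [Fintype V] (G : SimpleGraph V) [DecidableRel G.Adj]
      (A B : Finset V), IsBalancedBipartition G A B n →
      (1 / 2 + g) * (n : ℝ) ≤ (G.minDegree : ℝ) →
      ∃ (k c : ℕ) (X Y : Fin k → Finset V) (R : Fin k → Fin k → Prop),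
        k₀ ≤ k ∧ k ≤ K₀ ∧ 1 ≤ ε₁ * (c : ℝ) ∧ (1 - ε₁) * (n : ℝ) ≤ k * c ∧
        (∀ i, X i ⊆ A ∧ (X i).card = c) ∧ (∀ i, Y i ⊆ B ∧ (Y i).card = c) ∧
        (∀ i j, i ≠ j → Disjoint (X i) (X j)) ∧ (∀ i j, i ≠ j → Disjoint (Y i) (Y j)) ∧
        (∀ i j, R i j → G.IsUniform ε₁ (X i) (Y j) ∧ g / 4 ≤ (G.edgeDensity (X i) (Y j) : ℝ)) ∧
        (∀ i, (1 / 2 + g / 4) * (k : ℝ) ≤ ({j | R i j}.ncard : ℝ)) ∧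
        (∀ j, (1 / 2 + g / 4) * (k : ℝ) ≤ ({i | R i j}.ncard : ℝ)) := by
  classical
  -- `η n` bounds each kind of loss: vertices outside the chunks, bad partners of a kept chunk, and
  -- discarded chunks. `ε₀` is small enough for uniformity to pass to chunks, which are at least
  -- `η / 8` times as large as parts, and for all but `η n` vertices to lie in kept chunks.
  set η := ε₁ / 8 with hη
  have hη0 : 0 < η := by positivity
  have hη1 : η ≤ 1 / 16 := by rw [hη]; linarith
  set ε₀ := η ^ 2 / 32 with hε₀
  have hε₀0 : 0 < ε₀ := by positivity
  -- at least `1 / ε₀` parts, to make the diagonal pairs of parts negligible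
  set l := max k₀ ⌈1 / ε₀⌉₊
  set M := SzemerediRegularity.bound ε₀ l
  set K₀ := max (⌈2 * (M : ℝ) / η ^ 2⌉₊ + 1) l with hK₀
  refine ⟨K₀, fun n hn V _ G _ A B hAB hdeg => ?_⟩
  have hnM : 2 * (M : ℝ) / η ^ 2 ≤ n := by
    refine (Nat.le_ceil _).trans ?_
    have : ⌈2 * (M : ℝ) / η ^ 2⌉₊ ≤ n := by omega
    exact_mod_cast this
  have hn0 : (0 : ℝ) < n := by
    have : 0 < n := by omega
    exact_mod_cast this
  have hV : Fintype.card V = 2 * n := by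
    have h1 : Disjoint A B := by exact_mod_cast hAB.bipartite.disjoint
    have h2 : A ∪ B = Finset.univ := by
      ext v
      simp [hAB.cover v]
    rw [← Finset.card_univ, ← h2, Finset.card_union_of_disjoint h1, hAB.card_left, hAB.card_right]
    ring
  obtain ⟨P, hPeq, hPl, hPM, hPU⟩ := szemeredi_regularity G hε₀0 (l := l) (by rw [hV]; omega)
  set p := P.parts.card with hp
  have hlε : 1 / ε₀ ≤ (p : ℝ) := by
    refine (Nat.le_ceil _).trans ?_
    have : ⌈1 / ε₀⌉₊ ≤ p := le_trans (le_max_right _ _) hPl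
    exact_mod_cast this
  have hp0 : (0 : ℝ) < p := lt_of_lt_of_le (by positivity) hlε
  have hpM : (p : ℝ) ≤ M := by exact_mod_cast hPM
  have hηn : 2 * (M : ℝ) ≤ η ^ 2 * n := by
    rw [div_le_iff₀ (by positivity)] at hnM
    linarith
  -- the chunk size
  set s := ⌊η * n / p⌋₊ with hs
  have hsle : (s : ℝ) * p ≤ η * n := by
    have := Nat.floor_le (by positivity : 0 ≤ η * n / p)
    rwa [le_div_iff₀ hp0] at this
  have hbig : 2 / η ≤ η * n / p := by
    rw [div_le_div_iff₀ hη0 hp0]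
    nlinarith
  have h2η : 2 ≤ 2 / η := by
    rw [le_div_iff₀ hη0]
    linarith
  have hsge : η * n / p / 2 ≤ s := by
    have := Nat.lt_floor_add_one (η * n / p)
    rw [← hs] at this
    linarith
  have hs1 : 1 / η ≤ s := by
    have : 1 / η = 2 / η / 2 := by ring
    linarith
  have hs0 : (0 : ℝ) < s := lt_of_lt_of_le (by positivity) hs1
  have hs0' : 0 < s := by exact_mod_cast hs0
  have hWcard : ∀ W ∈ P.parts, (W.card : ℝ) ≤ 4 * n / p := by
    intro W hW
    have h1 := hPeq.card_part_le_average_add_one hW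
    rw [Finset.card_univ, hV] at h1
    have h2 : (W.card : ℝ) ≤ ((2 * n / p : ℕ) : ℝ) + 1 := by exact_mod_cast h1
    have h3 : ((2 * n / p : ℕ) : ℝ) ≤ ((2 * n : ℕ) : ℝ) / p := Nat.cast_div_le
    push_cast at h3
    have h4 : 1 ≤ 2 * (n : ℝ) / p := by
      rw [le_div_iff₀ hp0]
      nlinarith
    have h5 : 4 * (n : ℝ) / p = 2 * n / p + 2 * n / p := by ring
    linarith
  have hρ : ∀ W ∈ P.parts, η / 8 * (W.card : ℝ) ≤ s := by
    intro W hW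
    have h1 := mul_le_mul_of_nonneg_left (hWcard W hW) (by positivity : 0 ≤ η / 8)
    have h2 : η / 8 * (4 * n / p) = η * n / p / 2 := by ring
    linarith
  -- both sides are cut into chunks, and chunks with many bad partners are discarded
  have hside : ∀ A' : Finset V, ∃ F : Finset (Finset V),
      (∀ X ∈ F, X ⊆ A' ∧ X.card = s ∧ ∃ W ∈ P.parts, X ⊆ W) ∧
      (∀ X ∈ F, ∀ Y ∈ F, X ≠ Y → Disjoint X Y) ∧
      ((A' \ F.biUnion id).card : ℝ) ≤ η * n := by
    intro A'
    obtain ⟨F, h1, h2, h3⟩ := exists_disjoint_chunks P A' hs0'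
    refine ⟨F, h1, h2, ?_⟩
    have h4 : ((A' \ F.biUnion id).card : ℝ) ≤ p * s := by exact_mod_cast h3
    linarith
  obtain ⟨F, hF, hFd, hFc⟩ := hside A
  obtain ⟨F', hF', hFd', hFc'⟩ := hside B
  have hlightcount : ∀ (A' : Finset V) (F F' : Finset (Finset V)), A'.card = n →
      (∀ X ∈ F, X ⊆ A' ∧ X.card = s ∧ ∃ W ∈ P.parts, X ⊆ W) →
      (∀ X ∈ F, ∀ Y ∈ F, X ≠ Y → Disjoint X Y) → ((A' \ F.biUnion id).card : ℝ) ≤ η * n →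
      (∀ X ∈ F', X.card = s ∧ ∃ W ∈ P.parts, X ⊆ W) →
      (∀ X ∈ F', ∀ Y ∈ F', X ≠ Y → Disjoint X Y) →
      (F.card : ℝ) * s ≤ n ∧ (1 - 2 * η) * n ≤ ((F.filter fun X =>
        ((F'.filter fun Y => ¬ InUniformParts G P ε₀ X Y).card : ℝ) * s ≤ η * n).card : ℝ) * s := by
    intro A' F F' hA' hF hFd hFc hF' hFd'
    have h1 := card_bad_pairs_le G P (fun X hX => (hF X hX).2) hF' hFd hFd' hWcard hPU hε₀0.le
    have h2 : ((p : ℝ) ^ 2 * ε₀ + p) * (4 * n / p) ^ 2 ≤ (η * n) ^ 2 := by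
      have h3 : (p : ℝ) ≤ (p : ℝ) ^ 2 * ε₀ := by
        rw [div_le_iff₀ hε₀0] at hlε
        nlinarith
      calc ((p : ℝ) ^ 2 * ε₀ + p) * (4 * n / p) ^ 2
          ≤ ((p : ℝ) ^ 2 * ε₀ + (p : ℝ) ^ 2 * ε₀) * (4 * n / p) ^ 2 := by gcongr
        _ = (η * n) ^ 2 := by
          rw [hε₀]
          field_simp
          ring
    have h3 := card_sub_card_light_le (F := F)
      (b := fun X => ((F'.filter fun Y => ¬ InUniformParts G P ε₀ X Y).card : ℝ)) hs0.le
      (by positivity : 0 < η * n) (fun _ _ => Nat.cast_nonneg _) (h1.trans h2)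
    have h4 := card_biUnion_chunks (fun X hX => (hF X hX).2.1) hFd
    have hsub : F.biUnion id ⊆ A' := Finset.biUnion_subset.2 fun X hX => (hF X hX).1
    have h5 := Finset.card_sdiff_add_card_eq_card hsub
    rw [h4, hA'] at h5
    have h6 : ((A' \ F.biUnion id).card : ℝ) + (F.card : ℝ) * s = n := by exact_mod_cast h5
    have h7 : (0 : ℝ) ≤ (A' \ F.biUnion id).card := Nat.cast_nonneg _
    constructor
    · linarith
    · linarith
  obtain ⟨hFn, hL⟩ := hlightcount A F F' hAB.card_left hF hFd hFc (fun X hX => (hF' X hX).2) hFd'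
  obtain ⟨hFn', hL'⟩ := hlightcount B F' F hAB.card_right hF' hFd' hFc'
    (fun X hX => (hF X hX).2) hFd
  set L := F.filter fun X =>
    ((F'.filter fun Y => ¬ InUniformParts G P ε₀ X Y).card : ℝ) * s ≤ η * n with hLdef
  set L' := F'.filter fun X =>
    ((F.filter fun Y => ¬ InUniformParts G P ε₀ X Y).card : ℝ) * s ≤ η * n with hLdef'
  set k := min L.card L'.card with hk
  obtain ⟨K, hKL, hKk⟩ := Finset.exists_subset_card_eq (min_le_left L.card L'.card)
  obtain ⟨K', hKL', hKk'⟩ := Finset.exists_subset_card_eq (min_le_right L.card L'.card)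
  rw [← hk] at hKk hKk'
  have hKF : K ⊆ F := hKL.trans (Finset.filter_subset _ _)
  have hKF' : K' ⊆ F' := hKL'.trans (Finset.filter_subset _ _)
  have hks : (1 - 2 * η) * n ≤ (k : ℝ) * s := by
    rcases min_choice L.card L'.card with h | h
    · rw [hk, h]; exact hL
    · rw [hk, h]; exact hL'
  have hksn : (k : ℝ) * s ≤ n := by
    refine le_trans (mul_le_mul_of_nonneg_right ?_ hs0.le) hFn
    rw [← hKk]
    exact_mod_cast Finset.card_le_card hKF
  let e := Finset.equivFinOfCardEq hKk
  let e' := Finset.equivFinOfCardEq hKk'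
  let X : Fin k → Finset V := fun i => e.symm i
  let Y : Fin k → Finset V := fun i => e'.symm i
  have hXK : ∀ i, X i ∈ K := fun i => (e.symm i).2
  have hYK : ∀ i, Y i ∈ K' := fun i => (e'.symm i).2
  refine ⟨k, s, X, Y, fun i j => InUniformParts G P ε₀ (X i) (Y j) ∧
    g / 4 ≤ (G.edgeDensity (X i) (Y j) : ℝ), ?_, ?_, ?_, ?_, ?_, ?_, ?_, ?_, ?_, ?_, ?_⟩
  · have h1 : (p : ℝ) ≤ k := by
      have h2 : (s : ℝ) * p ≤ s * k := by
        have : η * n ≤ (1 - 2 * η) * n := mul_le_mul_of_nonneg_right (by linarith) hn0.le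
        linarith
      exact le_of_mul_le_mul_left h2 hs0
    have h2 : p ≤ k := by exact_mod_cast h1
    exact (le_max_left _ _).trans (hPl.trans h2)
  · have h1 : (k : ℝ) ≤ 2 * M / η ^ 2 := by
      have h2 : (k : ℝ) * (η * n / p / 2) ≤ n :=
        (mul_le_mul_of_nonneg_left hsge (Nat.cast_nonneg k)).trans hksn
      have h3 : (k : ℝ) * η ≤ 2 * p := by
        have h4 : (k : ℝ) * (η * n / p / 2) = (k * η) * n / (2 * p) := by field_simp
        rw [h4, div_le_iff₀ (by positivity)] at h2
        have h5 : (k : ℝ) * η * n ≤ 2 * p * n := by linarith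
        exact le_of_mul_le_mul_right h5 hn0
      rw [le_div_iff₀ (by positivity)]
      have h4 : (k : ℝ) * η ^ 2 ≤ k * η := by
        refine mul_le_mul_of_nonneg_left ?_ (Nat.cast_nonneg k)
        nlinarith
      linarith
    have h2 : k ≤ ⌈2 * (M : ℝ) / η ^ 2⌉₊ := by
      exact_mod_cast h1.trans (Nat.le_ceil _)
    omega
  · have h1 : 1 ≤ s * η := by rwa [div_le_iff₀ hη0] at hs1
    have h2 : ε₁ = 8 * η := by rw [hη]; ring
    rw [h2]
    linarith
  · refine le_trans (mul_le_mul_of_nonneg_right ?_ hn0.le) hks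
    rw [hη]
    linarith
  · exact fun i => ⟨(hF _ (hKF (hXK i))).1, (hF _ (hKF (hXK i))).2.1⟩
  · exact fun i => ⟨(hF' _ (hKF' (hYK i))).1, (hF' _ (hKF' (hYK i))).2.1⟩
  · intro i j hij
    exact hFd _ (hKF (hXK i)) _ (hKF (hXK j)) fun h => hij (e.symm.injective (Subtype.ext h))
  · intro i j hij
    exact hFd' _ (hKF' (hYK i)) _ (hKF' (hYK j)) fun h => hij (e'.symm.injective (Subtype.ext h))
  · rintro i j ⟨⟨W, hW, Z, hZ, hXW, hYZ, hU⟩, hdens⟩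
    refine ⟨?_, hdens⟩
    have hXc := (hF _ (hKF (hXK i))).2.1
    have hYc := (hF' _ (hKF' (hYK j))).2.1
    refine isUniform_of_subset G (ρ := η / 8) hU hXW hYZ ?_ ?_ hε₁.le (by linarith) ?_ ?_
    · rw [hXc]; exact hρ W hW
    · rw [hYc]; exact hρ Z hZ
    · rw [hε₀, hη]; nlinarith [sq_nonneg ε₁]
    · rw [hε₀, hη]; nlinarith
  · intro i
    rw [show {j | InUniformParts G P ε₀ (X i) (Y j) ∧ g / 4 ≤ (G.edgeDensity (X i) (Y j) : ℝ)}.ncard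
      = _ from ncard_setOf_equiv_symm e' fun Z => InUniformParts G P ε₀ (X i) Z ∧
        g / 4 ≤ (G.edgeDensity (X i) Z : ℝ), ← hKk']
    refine reduced_degree G hg.le (by rw [hη]; linarith) hs0' (hF _ (hKF (hXK i))).2.1
      (fun Z hZ => ⟨(hF' Z hZ).1, (hF' Z hZ).2.1⟩) hFd' hAB.card_right hFc' ?_
      (Finset.mem_filter.1 (hKL (hXK i))).2 hKF' ?_
    · intro x hx
      refine hdeg.trans ?_
      exact_mod_cast hAB.minDegree_le_degInto ((hF _ (hKF (hXK i))).1 hx)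
    · rw [hKk']
      linarith
  · intro j
    have hsymm : ∀ i,
        (InUniformParts G P ε₀ (X i) (Y j) ∧ g / 4 ≤ (G.edgeDensity (X i) (Y j) : ℝ)) ↔
        (InUniformParts G P ε₀ (Y j) (X i) ∧ g / 4 ≤ (G.edgeDensity (Y j) (X i) : ℝ)) := by
      intro i
      rw [G.edgeDensity_comm]
      exact and_congr_left fun _ => ⟨InUniformParts.symm, InUniformParts.symm⟩
    simp only [hsymm]
    rw [show {i | InUniformParts G P ε₀ (Y j) (X i) ∧ g / 4 ≤ (G.edgeDensity (Y j) (X i) : ℝ)}.ncard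
      = _ from ncard_setOf_equiv_symm e fun Z => InUniformParts G P ε₀ (Y j) Z ∧
        g / 4 ≤ (G.edgeDensity (Y j) Z : ℝ), ← hKk]
    refine reduced_degree G hg.le (by rw [hη]; linarith) hs0' (hF' _ (hKF' (hYK j))).2.1
      (fun Z hZ => ⟨(hF Z hZ).1, (hF Z hZ).2.1⟩) hFd hAB.card_left hFc ?_
      (Finset.mem_filter.1 (hKL' (hYK j))).2 hKF ?_
    · intro x hx
      refine hdeg.trans ?_
      exact_mod_cast hAB.swap.minDegree_le_degInto ((hF' _ (hKF' (hYK j))).1 hx)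
    · rw [hKk]
      linarith

/-! ### Partitions with prescribed class sizes -/

theorem sum_degInto_le {V : Type*} {k n c : ℕ} (G : SimpleGraph V) [DecidableRel G.Adj] {θ : ℝ}
    (hθ : 0 ≤ θ) {B : Finset V} {Y : Fin k → Finset V} (hB : B.card = n)
    (hY : ∀ i, Y i ⊆ B ∧ (Y i).card = c) (hYd : ∀ i j, i ≠ j → Disjoint (Y i) (Y j)) (v : V) :
    (degInto G B v : ℝ) ≤ (n - k * c) +
      ({j | θ * c ≤ (degInto G (Y j) v : ℝ)}.ncard : ℝ) * c + θ * (k * c) := by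
  classical
  set U := Finset.univ.biUnion Y with hU
  have hUB : U ⊆ B := Finset.biUnion_subset.2 fun i _ => (hY i).1
  have hUc : U.card = k * c := by
    rw [hU, Finset.card_biUnion fun i _ j _ hij => hYd i j hij,
      Finset.sum_const_nat fun i _ => (hY i).2, Finset.card_univ, Fintype.card_fin]
  have h1 : (degInto G B v : ℝ) ≤ (B \ U).card + ∑ j, (degInto G (Y j) v : ℝ) := by
    have h2 : degInto G B v ≤ (B \ U).card + ∑ j, degInto G (Y j) v := by
      calc degInto G B v = degInto G ((B \ U) ∪ U) v := by rw [Finset.sdiff_union_of_subset hUB]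
        _ ≤ _ := degInto_union_le G _ _ v
        _ ≤ _ := add_le_add (degInto_le_card G _ v) (degInto_biUnion_le G _ Y v)
    exact_mod_cast h2
  have h2 : ((B \ U).card : ℝ) = n - k * c := by
    have := Finset.card_sdiff_add_card_eq_card hUB
    rw [hUc, hB] at this
    have h3 : ((B \ U).card : ℝ) + k * c = n := by exact_mod_cast this
    linarith
  have h3 : ∀ j, (degInto G (Y j) v : ℝ) ≤
      (if θ * c ≤ (degInto G (Y j) v : ℝ) then 1 else 0) * (c : ℝ) + θ * c := by
    intro j
    have h4 : (degInto G (Y j) v : ℝ) ≤ c := by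
      rw [← (hY j).2]
      exact_mod_cast degInto_le_card G _ v
    have h5 : 0 ≤ θ * c := mul_nonneg hθ (Nat.cast_nonneg c)
    split_ifs with h <;> linarith
  have h4 := Finset.sum_le_sum fun j (_ : j ∈ Finset.univ) => h3 j
  rw [Finset.sum_add_distrib, ← Finset.sum_mul, Finset.sum_boole, Finset.sum_const, nsmul_eq_mul,
    Finset.card_univ, Fintype.card_fin] at h4
  have h5 : ({j | θ * c ≤ (degInto G (Y j) v : ℝ)}.ncard : ℝ)
      = ((Finset.univ.filter fun j => θ * c ≤ (degInto G (Y j) v : ℝ)).card : ℝ) := by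
    rw [← Set.ncard_coe_finset]
    simp
  rw [h5]
  linarith

set_option maxHeartbeats 800000 in
/-- One side of the construction: `A` is partitioned into classes `P i` of the prescribed sizes
`a i`, close to the clusters `X i`, so that every vertex of `P i` has many neighbours in `Y i`.

The vertices outside the cores and the vertices exchanged for them meet in a cluster `j` for which
the former have many neighbours in `Y j` and which is adjacent to the target cluster in the reduced
graph; as more than half of the clusters satisfy either condition, there are many such `j`. -/
theorem exists_side_partition {V : Type*} {k n c : ℕ} (G : SimpleGraph V)
    [DecidableRel G.Adj] {g ε₁ : ℝ} (hg : 0 < g) (hg' : g ≤ 1 / 2) (hε₁ : 0 < ε₁)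
    (hε₁g : ε₁ ≤ g ^ 2 / 4096) {A B : Finset V} (hA : A.card = n) (hB : B.card = n)
    (hdeg : ∀ v ∈ A, (1 / 2 + g) * (n : ℝ) ≤ (degInto G B v : ℝ))
    {X Y : Fin k → Finset V} {R : Fin k → Fin k → Prop}
    (hc : 1 ≤ ε₁ * (c : ℝ)) (hkc : (1 - ε₁) * (n : ℝ) ≤ k * c)
    (hX : ∀ i, X i ⊆ A ∧ (X i).card = c) (hY : ∀ i, Y i ⊆ B ∧ (Y i).card = c)
    (hXd : ∀ i j, i ≠ j → Disjoint (X i) (X j)) (hYd : ∀ i j, i ≠ j → Disjoint (Y i) (Y j))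
    (hR : ∀ i j, R i j → G.IsUniform ε₁ (X i) (Y j) ∧ g / 4 ≤ (G.edgeDensity (X i) (Y j) : ℝ))
    (hRdiag : ∀ i, R i i) (hRdeg : ∀ j, (1 / 2 + g / 4) * (k : ℝ) ≤ ({i | R i j}.ncard : ℝ))
    {a : Fin k → ℕ} (hasum : ∑ i, a i = n) (ha : ∀ i, (1 - 2 * ε₁) * (c : ℝ) ≤ a i)
    (ha' : ∀ i, (a i : ℝ) ≤ (1 + 4 * ε₁) * c) :
    ∃ P : Fin k → Finset V, IsPartitionInto A P ∧ (∀ i, (P i).card = a i) ∧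
      (∀ i, ∀ x ∈ P i, g / 8 * (c : ℝ) ≤ (degInto G (Y i) x : ℝ)) ∧
      (∀ i [DecidableEq V], ((P i \ X i).card : ℝ) ≤ 40 * ε₁ / g * c ∧
        ((X i \ P i).card : ℝ) ≤ 40 * ε₁ / g * c) := by
  classical
  have hε₁1 : ε₁ ≤ g / 8192 := by nlinarith
  have hc0 : (0 : ℝ) < c := by
    by_contra! h
    nlinarith
  have hc0' : 0 < c := by exact_mod_cast hc0
  have hk0 : (0 : ℝ) ≤ k := Nat.cast_nonneg k
  set δ := 32 * ε₁ / g with hδ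
  have hδg : δ * g = 32 * ε₁ := by rw [hδ]; field_simp
  have hδ0 : 0 < δ := by positivity
  have hδε : 64 * ε₁ ≤ δ := by nlinarith
  have hδ1 : δ ≤ 1 / 128 := by nlinarith
  have hkcn : (k : ℝ) * c ≤ n := by
    have h1 : (Finset.univ.biUnion X).card ≤ A.card :=
      Finset.card_le_card (Finset.biUnion_subset.2 fun i _ => (hX i).1)
    rw [Finset.card_biUnion fun i _ j _ hij => hXd i j hij,
      Finset.sum_const_nat fun i _ => (hX i).2, Finset.card_univ, Fintype.card_fin, hA] at h1
    exact_mod_cast h1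
  -- In a pair of the reduced graph few vertices have low degree.
  have htyp : ∀ i j, R i j →
      (((X i).filter fun x => (degInto G (Y j) x : ℝ) < g / 8 * c).card : ℝ) ≤ ε₁ * c := by
    intro i j hij
    have h1 := card_atypical_le G (hR i j hij).1 (by linarith) (hR i j hij).2
      (by linarith : g / 8 ≤ g / 4 - ε₁) (Finset.card_pos.1 (by rw [(hY j).2]; exact hc0'))
    rwa [(hX i).2, (hY j).2] at h1
  -- the cores
  set c' := ⌈(1 - 3 * ε₁) * c⌉₊ with hc'
  have hc'1 : (1 - 3 * ε₁) * c ≤ c' := Nat.le_ceil _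
  have hc'2 : (c' : ℝ) ≤ (1 - 2 * ε₁) * c := by
    have h1 := Nat.ceil_lt_add_one (mul_nonneg (by linarith) hc0.le : 0 ≤ (1 - 3 * ε₁) * (c : ℝ))
    rw [← hc'] at h1
    linarith
  have hcore : ∀ i, ∃ C : Finset V, C ⊆ X i ∧ C.card = c' ∧
      ∀ x ∈ C, g / 8 * (c : ℝ) ≤ (degInto G (Y i) x : ℝ) := by
    intro i
    have h1 : (((X i).filter fun x => (degInto G (Y i) x : ℝ) < g / 8 * c).card : ℝ)
        + ((X i).filter fun x => ¬ (degInto G (Y i) x : ℝ) < g / 8 * c).card = (X i).card := by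
      exact_mod_cast Finset.card_filter_add_card_filter_not _
    have h2 := htyp i i (hRdiag i)
    rw [(hX i).2] at h1
    have h3 : (c' : ℝ) ≤ ((X i).filter fun x => ¬ (degInto G (Y i) x : ℝ) < g / 8 * c).card := by
      nlinarith
    obtain ⟨C, hC, hCc⟩ := Finset.exists_subset_card_eq (Nat.cast_le.1 h3)
    exact ⟨C, hC.trans (Finset.filter_subset _ _), hCc,
      fun x hx => not_lt.1 (Finset.mem_filter.1 (hC hx)).2⟩
  choose C hCX hCc hCdeg using hcore
  -- The reservoirs of exchangeable vertices: `δ c` is so large that they have room for all vertices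
  -- outside the cores, yet small compared with `c`.
  set q := ⌈δ * c⌉₊ with hq
  have hq1 : δ * c ≤ q := Nat.le_ceil _
  have hq2 : (q : ℝ) ≤ (δ + ε₁) * c := by
    have h1 := Nat.ceil_lt_add_one (mul_nonneg hδ0.le hc0.le : 0 ≤ δ * (c : ℝ))
    rw [← hq] at h1
    linarith
  have hqc : q ≤ c' := by
    have : (q : ℝ) ≤ c' := by nlinarith
    exact_mod_cast this
  choose D hDC hDc using fun i => Finset.exists_subset_card_eq (hqc.trans (hCc i).ge)
  have hCd : ∀ i j, i ≠ j → Disjoint (C i) (C j) := fun i j hij =>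
    Finset.disjoint_of_subset_left (hCX i) (Finset.disjoint_of_subset_right (hCX j) (hXd i j hij))
  have hmove : ∀ v ∈ A, ∀ t, ∃ S : Finset V, A.card - ∑ i, (C i).card ≤ S.card ∧
      ∀ u ∈ S, ∃ j, u ∈ D j ∧ g / 8 * (c : ℝ) ≤ (degInto G (Y j) v : ℝ) ∧
        g / 8 * (c : ℝ) ≤ (degInto G (Y t) u : ℝ) := by
    intro v hv t
    set J := Finset.univ.filter fun j => g / 8 * (c : ℝ) ≤ (degInto G (Y j) v : ℝ) ∧ R j t with hJ
    refine ⟨J.biUnion fun j => (D j).filter fun u => g / 8 * (c : ℝ) ≤ (degInto G (Y t) u : ℝ),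
      ?_, ?_⟩
    · -- More than half of the clusters receive `v`, and more than half are adjacent to `t`.
      have hJcard : 3 * g / 4 * k ≤ (J.card : ℝ) := by
        have h1 := (hdeg v hv).trans (sum_degInto_le G (by linarith : 0 ≤ g / 8) hB hY hYd v)
        set S₁ := {j | g / 8 * (c : ℝ) ≤ (degInto G (Y j) v : ℝ)} with hS₁
        have h2 : (1 / 2 + g / 2) * k ≤ (S₁.ncard : ℝ) := by
          refine le_of_mul_le_mul_right ?_ hc0
          nlinarith
        have h3 := Set.ncard_union_add_ncard_inter S₁ {j | R j t} (Set.toFinite _) (Set.toFinite _)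
        have h4 : (S₁ ∪ {j | R j t}).ncard ≤ k := by
          have := Set.ncard_le_card (S₁ ∪ {j | R j t})
          rwa [Nat.card_eq_fintype_card, Fintype.card_fin] at this
        have h5 : (S₁ ∩ {j | R j t}).ncard = J.card := by
          rw [← Set.ncard_coe_finset]
          congr 1
          ext j
          simp [hJ, hS₁]
        rw [h5] at h3
        have h6 : (S₁.ncard : ℝ) + ({j | R j t}.ncard : ℝ) ≤ k + J.card := by
          have : S₁.ncard + {j | R j t}.ncard ≤ k + J.card := by omega
          exact_mod_cast this
        have h7 := hRdeg t
        linarith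
      have hDt : ∀ j ∈ J, (δ - ε₁) * c ≤
          (((D j).filter fun u => g / 8 * (c : ℝ) ≤ (degInto G (Y t) u : ℝ)).card : ℝ) := by
        intro j hj
        have h1 : ((D j).filter fun u => (degInto G (Y t) u : ℝ) < g / 8 * c).card
            ≤ ((X j).filter fun u => (degInto G (Y t) u : ℝ) < g / 8 * c).card :=
          Finset.card_le_card (Finset.filter_subset_filter _ ((hDC j).trans (hCX j)))
        have h2 := htyp j t (Finset.mem_filter.1 hj).2.2
        have h3 : (((D j).filter fun u => (degInto G (Y t) u : ℝ) < g / 8 * c).card : ℝ)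
            + ((D j).filter fun u => ¬ (degInto G (Y t) u : ℝ) < g / 8 * c).card = (D j).card := by
          exact_mod_cast Finset.card_filter_add_card_filter_not _
        simp only [not_lt] at h3
        rw [hDc] at h3
        have h4 : (((D j).filter fun u => (degInto G (Y t) u : ℝ) < g / 8 * c).card : ℝ)
            ≤ ((X j).filter fun u => (degInto G (Y t) u : ℝ) < g / 8 * c).card := by
          exact_mod_cast h1
        linarith
      have hDd : ∀ i ∈ J, ∀ j ∈ J, i ≠ j → Disjoint
          ((D i).filter fun u => g / 8 * (c : ℝ) ≤ (degInto G (Y t) u : ℝ))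
          ((D j).filter fun u => g / 8 * (c : ℝ) ≤ (degInto G (Y t) u : ℝ)) := by
        intro i _ j _ hij
        exact Finset.disjoint_of_subset_left ((Finset.filter_subset _ _).trans (hDC i))
          (Finset.disjoint_of_subset_right ((Finset.filter_subset _ _).trans (hDC j)) (hCd i j hij))
      rw [Finset.card_biUnion hDd, hA, Finset.sum_const_nat fun i _ => hCc i, Finset.card_univ,
        Fintype.card_fin, Nat.sub_le_iff_le_add]
      have h1 : (J.card : ℝ) * ((δ - ε₁) * c) ≤ ∑ j ∈ J,
          (((D j).filter fun u => g / 8 * (c : ℝ) ≤ (degInto G (Y t) u : ℝ)).card : ℝ) := by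
        rw [← nsmul_eq_mul]
        exact Finset.card_nsmul_le_sum _ _ _ hDt
      have h2 : 3 * g / 4 * k * ((δ / 2) * c) ≤ J.card * ((δ - ε₁) * c) :=
        mul_le_mul hJcard (mul_le_mul_of_nonneg_right (by linarith) hc0.le) (by positivity)
          (Nat.cast_nonneg _)
      have h3 : 3 * g / 4 * k * ((δ / 2) * c) = 12 * ε₁ * (k * c) := by
        calc _ = 3 / 8 * (δ * g) * (k * c) := by ring
          _ = _ := by rw [hδg]; ring
      have h4 : (1 - 3 * ε₁) * (k * c) ≤ k * c' := by
        nlinarith [mul_le_mul_of_nonneg_left hc'1 hk0]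
      have h5 : (n : ℝ) ≤ 12 * ε₁ * (k * c) + (1 - 3 * ε₁) * (k * c) := by
        nlinarith [mul_le_mul_of_nonneg_left hkc (by linarith : 0 ≤ 1 + 9 * ε₁),
          (Nat.cast_nonneg n : (0 : ℝ) ≤ n), mul_nonneg hε₁.le (Nat.cast_nonneg n : (0 : ℝ) ≤ n)]
      have h6 : (n : ℝ) ≤ ∑ j ∈ J,
          (((D j).filter fun u => g / 8 * (c : ℝ) ≤ (degInto G (Y t) u : ℝ)).card : ℝ)
            + k * c' := by
        linarith
      exact_mod_cast h6
    · intro u hu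
      obtain ⟨j, hj, hu⟩ := Finset.mem_biUnion.1 hu
      obtain ⟨hu1, hu2⟩ := Finset.mem_filter.1 hu
      exact ⟨j, hu1, (Finset.mem_filter.1 hj).2.1, hu2⟩
  obtain ⟨P, hP1, hP2, hP3, hP4⟩ := exists_reassignment A C D a
    (fun x i => g / 8 * (c : ℝ) ≤ (degInto G (Y i) x : ℝ)) (fun i => (hCX i).trans (hX i).1) hCd hDC
    (fun i => by rw [hCc]; exact Nat.cast_le.1 (hc'2.trans (ha i))) (by rw [hasum, hA]) hCdeg hmove
  refine ⟨P, hP1, hP2, hP3, fun i inst => ?_⟩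
  have hinst : inst = fun a b => Classical.propDecidable (a = b) := Subsingleton.elim _ _
  subst hinst
  have h1 : ((C i \ P i).card : ℝ) ≤ q := by
    rw [← hDc i]
    exact_mod_cast Finset.card_le_card (hP4 i)
  have h2 : 40 * ε₁ / g * c = (δ + 8 * ε₁ / g) * c := by rw [hδ]; ring
  have h3 : 16 * ε₁ ≤ 8 * ε₁ / g := by
    rw [le_div_iff₀ hg]
    nlinarith
  have h4 : (δ + 16 * ε₁) * c ≤ 40 * ε₁ / g * c := by
    rw [h2]
    exact mul_le_mul_of_nonneg_right (by linarith) hc0.le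
  constructor
  · have h5 : ((P i \ X i).card : ℝ) ≤ (P i \ C i).card := by
      exact_mod_cast Finset.card_le_card (Finset.sdiff_subset_sdiff (Finset.Subset.refl _) (hCX i))
    have h6 : ((P i \ C i).card : ℝ) + (C i).card = (C i \ P i).card + (P i).card := by
      have e1 := Finset.card_sdiff_add_card (P i) (C i)
      have e2 := Finset.card_sdiff_add_card (C i) (P i)
      rw [Finset.union_comm] at e2
      exact_mod_cast e1.trans e2.symm
    rw [hCc, hP2] at h6
    have h7 := ha' i
    nlinarith
  · have h5 : ((X i \ P i).card : ℝ) ≤ (X i \ C i).card + (C i \ P i).card := by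
      have h6 : X i \ P i ⊆ (X i \ C i) ∪ (C i \ P i) := by
        intro x hx
        obtain ⟨hx1, hx2⟩ := Finset.mem_sdiff.1 hx
        by_cases h : x ∈ C i
        · exact Finset.mem_union_right _ (Finset.mem_sdiff.2 ⟨h, hx2⟩)
        · exact Finset.mem_union_left _ (Finset.mem_sdiff.2 ⟨hx1, h⟩)
      exact_mod_cast (Finset.card_le_card h6).trans (Finset.card_union_le _ _)
    have h6 : ((X i \ C i).card : ℝ) + (C i).card = (X i).card := by
      exact_mod_cast Finset.card_sdiff_add_card_eq_card (hCX i)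
    rw [hCc, (hX i).2] at h6
    nlinarith

theorem IsRegularPair.mono {V : Type*} {G : SimpleGraph V} [DecidableRel G.Adj] {ε ε' d d' : ℝ}
    {U W : Finset V} (h : IsRegularPair G ε d U W) (hε : ε ≤ ε') (hd : d' ≤ d) :
    IsRegularPair G ε' d' U W := by
  refine ⟨h.disjoint, h.nonempty_left, h.nonempty_right, hd.trans h.density, ?_⟩
  intro U' W' hU hW hU0 hW0 hUc hWc
  exact (h.regular U' W' hU hW hU0 hW0
    ((mul_le_mul_of_nonneg_right hε (Nat.cast_nonneg _)).trans hUc)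
    ((mul_le_mul_of_nonneg_right hε (Nat.cast_nonneg _)).trans hWc)).trans hε

theorem IsPartitionInto.subset {V ι : Type*} {S : Finset V} {P : ι → Finset V}
    (h : IsPartitionInto S P) (i : ι) : P i ⊆ S := fun v hv => (h.union v).2 ⟨i, hv⟩

/-- If all vertices of `P` have many neighbours in `Y`, they have many in a set `Q` close to `Y`. -/
theorem mul_card_le_degInto {V : Type*} [DecidableEq V] (G : SimpleGraph V) [DecidableRel G.Adj]
    {θ β d c : ℝ} {Y Q : Finset V} {x : V} (hx : θ * c ≤ (degInto G Y x : ℝ))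
    (hYQ : ((Y \ Q).card : ℝ) ≤ β * c) (hQ : (Q.card : ℝ) ≤ 2 * c) (hd : 0 ≤ d) (hc : 0 ≤ c)
    (hβ : 2 * d + β ≤ θ) : d * (Q.card : ℝ) ≤ (degInto G Q x : ℝ) := by
  have h1 : degInto G Y x ≤ degInto G Q x + (Y \ Q).card := by
    calc degInto G Y x ≤ degInto G (Q ∪ Y \ Q) x :=
          degInto_mono G
            (by rw [Finset.union_sdiff_self_eq_union]; exact Finset.subset_union_right) x
      _ ≤ _ := degInto_union_le G _ _ x
      _ ≤ _ := Nat.add_le_add_left (degInto_le_card G _ x) _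
  have h2 : (degInto G Y x : ℝ) ≤ degInto G Q x + (Y \ Q).card := by exact_mod_cast h1
  have h3 := mul_le_mul_of_nonneg_left hQ hd
  have h4 := mul_le_mul_of_nonneg_right hβ hc
  linarith

/-- An equitable splitting of `n` into `k` summands. -/
theorem exists_equitable_sum {k : ℕ} (hk : 0 < k) (n : ℕ) :
    ∃ m : Fin k → ℕ, ∑ i, m i = n ∧
      ∀ i, (n : ℝ) / k - 1 ≤ (m i : ℝ) ∧ (m i : ℝ) ≤ (n : ℝ) / k + 1 := by
  refine ⟨fun i => n / k + if (i : ℕ) < n % k then 1 else 0, ?_, fun i => ?_⟩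
  · have h1 : ∑ i : Fin k, (if (i : ℕ) < n % k then 1 else 0) = n % k := by
      rw [Fin.sum_univ_eq_sum_range (fun i => if i < n % k then 1 else 0) k, Finset.sum_boole]
      have : (Finset.range k).filter (fun i => i < n % k) = Finset.range (n % k) := by
        ext i
        have := Nat.mod_lt n hk
        simp only [Finset.mem_filter, Finset.mem_range]
        omega
      rw [this, Finset.card_range]
      rfl
    rw [Finset.sum_add_distrib, h1, Finset.sum_const, Finset.card_univ, Fintype.card_fin,
      smul_eq_mul]
    exact Nat.div_add_mod n k
  · have hk' : (0 : ℝ) < k := by exact_mod_cast hk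
    have h1 : ((n / k : ℕ) : ℝ) ≤ n / k := Nat.cast_div_le
    have h2 : (n : ℝ) / k ≤ ((n / k : ℕ) : ℝ) + 1 := by
      rw [div_le_iff₀ hk']
      have := (Nat.lt_div_mul_add hk : n < n / k * k + k).le
      have h3 : (n : ℝ) ≤ ((n / k : ℕ) : ℝ) * k + k := by exact_mod_cast this
      linarith
    push_cast
    split_ifs <;> constructor <;> linarith

/-- Summands bounded by `m i + x` with the same total as the `m i` are at least `m i - k x`. -/
theorem sub_mul_le_of_sum_eq {k : ℕ} {a m : Fin k → ℕ} {x : ℝ} (hx : 0 ≤ x)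
    (hsum : ∑ i, a i = ∑ i, m i) (ha : ∀ i, (a i : ℝ) ≤ m i + x) (i : Fin k) :
    (m i : ℝ) - k * x ≤ a i := by
  have h1 := Finset.single_le_sum (f := fun i => (m i : ℝ) + x - a i)
    (fun j _ => by linarith [ha j]) (Finset.mem_univ i)
  have h2 : ∑ j, ((m j : ℝ) + x - a j) = k * x := by
    rw [Finset.sum_sub_distrib, Finset.sum_add_distrib]
    have : (∑ j, (a j : ℝ)) = ∑ j, (m j : ℝ) := by exact_mod_cast hsum
    rw [this]
    simp
  rw [h2] at h1
  linarith

set_option maxHeartbeats 600000 in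
theorem lemma8 :
    ∀ γ : ℝ, 0 < γ → ∃ d : ℝ, 0 < d ∧
      ∀ ε : ℝ, 0 < ε → ∀ k₀ : ℕ, ∃ K₀ : ℕ, ∃ ξ : ℝ, 0 < ξ ∧
        ∀ n : ℕ, K₀ ≤ n →
          ∀ (V : Type*) [Fintype V] (G : SimpleGraph V) [DecidableRel G.Adj] (A B : Finset V),
            IsBalancedBipartition G A B n →
            (1 / 2 + γ) * (n : ℝ) ≤ (G.minDegree : ℝ) →
            ∃ k : ℕ, k₀ ≤ k ∧ k ≤ K₀ ∧
              ∃ m : Fin k → ℕ, ∑ i, m i = n ∧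
                (∀ i, (n : ℝ) / (2 * (k : ℝ)) ≤ (m i : ℝ)) ∧
                ∀ a b : Fin k → ℕ, ∑ i, a i = n → ∑ i, b i = n →
                  (∀ i, (a i : ℝ) ≤ (m i : ℝ) + ξ * (n : ℝ)) →
                  (∀ i, (b i : ℝ) ≤ (m i : ℝ) + ξ * (n : ℝ)) →
                  ∃ P Q : Fin k → Finset V,
                    IsPartitionInto A P ∧ IsPartitionInto B Q ∧
                    (∀ i, (P i).card = a i ∧ (Q i).card = b i) ∧
                    (∀ i, IsSuperRegularPair G ε d (P i) (Q i)) ∧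
                    (∀ i, IsRegularPair G ε d (P i) (Q (finRotate k i))) := by
  intro γ hγ
  set g := min γ (1 / 2) with hg
  have hg0 : 0 < g := lt_min hγ (by norm_num)
  have hg1 : g ≤ 1 / 2 := min_le_right _ _
  refine ⟨g / 32, by positivity, fun ε hε k₀ => ?_⟩
  set ε' := min ε (g / 8) with hε'
  have hε'0 : 0 < ε' := lt_min hε (by positivity)
  have hε'ε : ε' ≤ ε := min_le_left _ _
  have hε'g : ε' ≤ g / 8 := min_le_right _ _
  -- The classes will differ from the clusters by a proportion `40 ε₁ / g`, which has to be at most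
  -- `ε' ^ 2 / 16` for regularity and at most `g / 16` for the degrees.
  set ε₁ := ε' ^ 2 * g / 4096 with hε₁
  have hε₁0 : 0 < ε₁ := by positivity
  have hε'sq : ε' ^ 2 ≤ g / 128 := by nlinarith
  have hε₁g : ε₁ ≤ g ^ 2 / 4096 := by
    rw [hε₁]
    nlinarith
  have hε₁ε : ε₁ ≤ ε' / 8 := by
    rw [hε₁]
    nlinarith
  have hε₁1 : ε₁ ≤ 1 / 16 := by linarith
  have hβ : 40 * ε₁ / g = 40 * ε' ^ 2 / 4096 := by
    rw [hε₁]
    field_simp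
  obtain ⟨K₁, hK₁⟩ := exists_reduced_structure hg0 hg1 hε₁0 (by linarith) (max k₀ 1)
  -- `n ≥ 2 k` makes up for rounding in `n_i ≥ n / (2 k)`
  set K₀ := 2 * K₁ + 1
  have hK₀0 : (0 : ℝ) < K₀ := by positivity
  refine ⟨K₀, ε₁ / (4 * (K₀ : ℝ) ^ 2), by positivity, fun n hn V _ G _ A B hAB hdeg => ?_⟩
  classical
  have hn0 : (0 : ℝ) < n := by
    have : 0 < n := by omega
    exact_mod_cast this
  have hdeg' : (1 / 2 + g) * (n : ℝ) ≤ G.minDegree :=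
    (mul_le_mul_of_nonneg_right (by linarith [min_le_left γ (1 / 2 : ℝ)]) hn0.le).trans hdeg
  obtain ⟨k, c, X, Y, R, hk₀, hkK, hc, hkc, hX, hY, hXd, hYd, hR, hRl, hRr⟩ :=
    hK₁ n (by omega) V G A B hAB hdeg'
  have hk1 : 1 ≤ k := (le_max_right _ _).trans hk₀
  have hk0 : (0 : ℝ) < k := by exact_mod_cast hk1
  obtain ⟨m, hm, hmn⟩ := exists_equitable_sum hk1 n
  refine ⟨k, (le_max_left _ _).trans hk₀, by omega, m, hm, ?_, ?_⟩
  · intro i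
    have h1 : 2 * (k : ℝ) ≤ n := by
      have : 2 * k ≤ n := by omega
      exact_mod_cast this
    have h2 : (n : ℝ) / k = n / (2 * k) + n / (2 * k) := by field_simp; ring
    have h3 : 1 ≤ (n : ℝ) / (2 * k) := by
      rw [le_div_iff₀ (by positivity)]
      linarith
    linarith [(hmn i).1]
  intro a b ha hb ham hbm
  -- the deviations allowed by `ξ` are negligible compared with the cluster size
  have hc0 : (0 : ℝ) < c := by
    by_contra! h
    nlinarith
  have hnk : (n : ℝ) / k ≤ (1 + 2 * ε₁) * c := by
    rw [div_le_iff₀ hk0]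
    have h1 : (1 + 2 * ε₁) * ((1 - ε₁) * n) ≤ (1 + 2 * ε₁) * (k * c) :=
      mul_le_mul_of_nonneg_left hkc (by linarith)
    have h2 : 1 ≤ (1 + 2 * ε₁) * (1 - ε₁) := by nlinarith
    have h3 := mul_le_mul_of_nonneg_right h2 hn0.le
    linarith
  have hcnk : (c : ℝ) ≤ n / k := by
    rw [le_div_iff₀ hk0]
    have h1 : (Finset.univ.biUnion X).card ≤ A.card :=
      Finset.card_le_card (Finset.biUnion_subset.2 fun i _ => (hX i).1)
    rw [Finset.card_biUnion fun i _ j _ hij => hXd i j hij,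
      Finset.sum_const_nat fun i _ => (hX i).2, Finset.card_univ, Fintype.card_fin,
      hAB.card_left, mul_comm] at h1
    exact_mod_cast h1
  have hξ : k * (ε₁ / (4 * (K₀ : ℝ) ^ 2) * n) ≤ ε₁ * c := by
    have h1 : (k : ℝ) ≤ K₀ := by
      have : k ≤ K₀ := by omega
      exact_mod_cast this
    calc k * (ε₁ / (4 * (K₀ : ℝ) ^ 2) * n) ≤ k * (ε₁ / (4 * (k : ℝ) ^ 2) * n) := by gcongr
      _ = ε₁ / 4 * (n / k) := by field_simp
      _ ≤ ε₁ / 4 * ((1 + 2 * ε₁) * c) := by gcongr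
      _ ≤ ε₁ * c := by nlinarith [mul_pos hε₁0 hc0]
  have hξ0 : 0 ≤ ε₁ / (4 * (K₀ : ℝ) ^ 2) * n := by positivity
  have hsize : ∀ a : Fin k → ℕ, ∑ i, a i = n →
      (∀ i, (a i : ℝ) ≤ (m i : ℝ) + ε₁ / (4 * (K₀ : ℝ) ^ 2) * n) →
      ∀ i, (1 - 2 * ε₁) * (c : ℝ) ≤ a i ∧ (a i : ℝ) ≤ (1 + 4 * ε₁) * c := by
    intro a ha ham i
    have h1 := sub_mul_le_of_sum_eq hξ0 (ha.trans hm.symm) ham i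
    have h2 : ε₁ / (4 * (K₀ : ℝ) ^ 2) * n ≤ k * (ε₁ / (4 * (K₀ : ℝ) ^ 2) * n) := by
      have : (1 : ℝ) ≤ k := by exact_mod_cast hk1
      nlinarith
    have h3 := ham i
    have h4 := hmn i
    constructor <;> linarith [h4.1, h4.2]
  have hdisj : Disjoint A B := by exact_mod_cast hAB.bipartite.disjoint
  -- arrange the clusters along a Hamilton cycle of the reduced graph
  have hham : ∀ s : ℕ, (1 / 2 + g / 4) * (k : ℝ) ≤ s → k < 2 * s := by
    intro s hs
    have h1 : (k : ℝ) < 2 * s := by nlinarith [mul_pos hg0 hk0]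
    exact_mod_cast h1
  obtain ⟨α, β, hαβ⟩ := exists_hamiltonian_arrangement R (fun i => hham _ (hRl i))
    fun j => hham _ (hRr j)
  have hpre : ∀ (σ : Equiv.Perm (Fin k)) (p : Fin k → Prop),
      {i | p (σ i)}.ncard = {i | p i}.ncard := by
    intro σ p
    rw [← Set.ncard_image_of_injective {i | p (σ i)} σ.injective]
    congr 1
    ext i
    constructor
    · rintro ⟨j, hj, rfl⟩
      exact hj
    · intro hi
      exact ⟨σ.symm i, by simpa using hi, by simp⟩
  obtain ⟨P, hP1, hP2, hP3, hP4⟩ := exists_side_partition G hg0 hg1 hε₁0 hε₁g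
    hAB.card_left hAB.card_right
    (fun v hv => hdeg'.trans (by exact_mod_cast hAB.minDegree_le_degInto hv))
    (X := fun i => X (α i)) (Y := fun i => Y (β i)) (R := fun i j => R (α i) (β j)) hc hkc
    (fun i => hX _) (fun i => hY _) (fun i j hij => hXd _ _ (α.injective.ne hij))
    (fun i j hij => hYd _ _ (β.injective.ne hij)) (fun i j hij => hR _ _ hij) (fun i => (hαβ i).1)
    (fun j => by rw [hpre α fun i => R i (β j)]; exact hRr _) ha (fun i => (hsize a ha ham i).1)
    (fun i => (hsize a ha ham i).2)
  obtain ⟨Q, hQ1, hQ2, hQ3, hQ4⟩ := exists_side_partition G hg0 hg1 hε₁0 hε₁g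
    hAB.card_right hAB.card_left
    (fun v hv => hdeg'.trans (by exact_mod_cast hAB.swap.minDegree_le_degInto hv))
    (X := fun i => Y (β i)) (Y := fun i => X (α i)) (R := fun i j => R (α j) (β i)) hc hkc
    (fun i => hY _) (fun i => hX _) (fun i j hij => hYd _ _ (β.injective.ne hij))
    (fun i j hij => hXd _ _ (α.injective.ne hij))
    (fun i j hij => ⟨(hR _ _ hij).1.symm, by rw [G.edgeDensity_comm]; exact (hR _ _ hij).2⟩)
    (fun i => (hαβ i).1)
    (fun j => by rw [hpre β fun i => R (α j) i]; exact hRl _) hb (fun i => (hsize b hb hbm i).1)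
    (fun i => (hsize b hb hbm i).2)
  have hreg : ∀ i j, R (α i) (β j) → IsRegularPair G ε (g / 32) (P i) (Q j) := by
    intro i j hij
    have hPi : (c : ℝ) / 2 ≤ (P i).card := by
      rw [hP2]
      nlinarith [(hsize a ha ham i).1]
    have hQj : (c : ℝ) / 2 ≤ (Q j).card := by
      rw [hQ2]
      nlinarith [(hsize b hb hbm j).1]
    refine (isRegularPair_of_isUniform G (hR _ _ hij).1 hε'0 (by linarith) hε₁ε
      (β := 40 * ε₁ / g) ?_ hc0 (by rw [(hX _).2]) (by rw [(hY _).2]) (hR _ _ hij).2 ?_ hPi hQj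
      (hP4 i).1 (hQ4 j).1).mono hε'ε (by linarith)
    · rw [hβ]
      nlinarith [sq_nonneg ε']
    · exact Finset.disjoint_of_subset_left (hP1.subset i)
        (Finset.disjoint_of_subset_right (hQ1.subset j) hdisj)
  have hβg : 2 * (g / 32) + 40 * ε₁ / g ≤ g / 8 := by
    rw [hβ]
    linarith
  refine ⟨P, Q, hP1, hQ1, fun i => ⟨hP2 i, hQ2 i⟩, fun i => ⟨hreg i i (hαβ i).1, ?_, ?_⟩,
    fun i => hreg _ _ (hαβ i).2⟩
  · intro u hu
    refine mul_card_le_degInto G (hP3 i u hu) (hQ4 i).2 ?_ (by positivity) hc0.le hβg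
    rw [hQ2]
    nlinarith [(hsize b hb hbm i).2]
  · intro w hw
    refine mul_card_le_degInto G (hQ3 i w hw) (hP4 i).2 ?_ (by positivity) hc0.le hβg
    rw [hP2]
    nlinarith [(hsize a ha ham i).2]
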